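/- All logarithms are to base $2$; $H(q)=-q\log q-(1-q)\log(1-q)$ is the binary entropy. **Channel.** The trapdoor channel has input, output and state in $\{0,1\}$. If the state is $s$ and the input is $x$, the output $y$ equals $x$ or $s$ with probability $\tfrac12$ each, and the next state is $s\oplus x\oplus y$. **Dynamic program.** The state is $z\in[0,1]$, the conditional probability, given the past outputs, that the channel state is $0$. An action is a stochastic matrix $u=(p(x|s))_{s,x}$; the disturbance is the channel output $y$, with its conditional law given $(z,u)$; the next state is the Bayes update of $z$ after $y$; the reward is $g(z,u)=I(X,S;Y\mid z,u)$. A policy $\pi$ chooses the action as a function of the past outputs. From the initial state $z_0$ its average reward is $\rho_\pi=\liminf_N \frac1N E_\pi\sum_{t=1}^{N} g(z_{t-1},u_t)$, and the optimal average reward is $\rho^*=\sup_\pi\rho_\pi$. With $\delta=z\,p(0|0)$ and $\gamma=(1-z)\,p(1|1)$ its dynamic programming operator is $$(Th)(z)=\sup_{0\le\delta\le z,\ 0\le\gamma\le 1-z}\Big(H\big(\tfrac12+\tfrac{\delta-\gamma}2\big)+\delta+\gamma-1+\tfrac{1+\delta-\gamma}2\,h\big(\tfrac{2\delta}{1+\delta-\gamma}\big)+\tfrac{1-\delta+\gamma}2\,h\big(1-\tfrac{2\gamma}{1-\delta+\gamma}\big)\Big),$$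 where a term with coefficient $0$ is $0$. **Conjectured solution.** Let $b_1=\sqrt5-2$, $b_2=\frac{3-\sqrt5}2$, $b_3=\frac{\sqrt5-1}2$, $b_4=3-\sqrt5$ and $\tilde\rho=\log\frac{1+\sqrt5}2$. On $[b_1,b_4]$ put $$(\tilde\gamma(z),\tilde\delta(z))=\begin{cases}(\frac{\sqrt5-1}2(1-z),\,z)& b_1\le z\le b_2\\ (\frac{3-\sqrt5}2,\,\frac{3-\sqrt5}2)& b_2\le z\le b_3\\ (1-z,\,\frac{\sqrt5-1}2 z)& b_3\le z\le b_4,\end{cases}\qquad \tilde h(z)=\begin{cases}H(z)-\tilde\rho z+\log(\sqrt5-1)& b_1\le z\le b_2\\ 1& b_2\le z\le b_3\\ H(z)+\tilde\rho z+\log(3-\sqrt5)& b_3\le z\le b_4.\end{cases}$$ Let $h_0$ be the pointwise maximum of the concave functions on $[0,1]$ that equal $\tilde h$ on $[b_1,b_4]$, let $h_{k+1}=Th_k-\tilde\rho$, and let $h^*=\limsup_k h_k$. **Theorem.** 1. $h_0$ is itself such a concave function; $h_k\to h^*$ uniformly on $[0,1]$; $h^*$ is bounded, and $\tilde\rho+h^*(z)=(Th^*)(z)$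 for all $z\in[0,1]$. 2. For every initial state $z_0\in[0,1]$, $\tilde\rho$ is the optimal average reward. 3. There is a measurable stationary policy that takes the actions $(\delta,\gamma)=(\tilde\delta(z),\tilde\gamma(z))$ whenever $z\in[b_1,b_4]$ and that is optimal from every initial state $z_0\in[0,1]$; on $[b_1,b_4]$ its actions attain the supremum in $(Th^*)(z)$. 4. For each initial channel state $s_0$, known to encoder and decoder, the feedback capacity of the trapdoor channel is $\log\frac{1+\sqrt5}2$ bits per channel use. Here the encoder computes $x_t$ from $s_0$, the message and $y_1,\dots,y_{t-1}$, the decoder estimates the message from $s_0$ and $y_1,\dots,y_N$, and the capacity is the supremum of the rates $R$ for which there are codes with $\lceil 2^{NR}\rceil$ messages and block length $N$ whose maximal error probability tends to $0$ as $N\to\infty$. -/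

import Mathlib

open Filter Set

namespace Trapdoor

noncomputable section

/-! ### The trapdoor channel

Balls labelled `0`, `1` are represented by `false`, `true`. -/

/-- `p(y | x, s)`: with input ball `x` and ball `s` in the channel, either ball leaves with
probability `1/2`. -/
def channelProb (x s y : Bool) : ℝ :=
  (if y = x then 1 / 2 else 0) + (if y = s then 1 / 2 else 0)

/-- The ball that remains in the channel, `s ⊕ x ⊕ y`. -/
def nextState (s x y : Bool) : Bool := Bool.xor (Bool.xor s x) y

/-! ### The belief-state dynamic program -/

/-- The state distribution `(z, 1 - z)` encoded by `z = P(s = 0)`. -/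
def belief (z : ℝ) (s : Bool) : ℝ := if s = false then z else 1 - z

/-- An action: a stochastic matrix, `u s x = p(x | s)`. -/
abbrev Action : Type :=
  {u : Bool → Bool → ℝ // (∀ s x, 0 ≤ u s x) ∧ ∀ s, ∑ x, u s x = 1}

/-- The joint law of `((x, s), y)` under belief `z` and action `u`. -/
def jointProb (z : ℝ) (u : Action) (a : Bool × Bool) (y : Bool) : ℝ :=
  belief z a.2 * u.1 a.2 a.1 * channelProb a.1 a.2 y

/-- The law `P_w(y | z, u)` of the disturbance, which is the channel output. -/
def outProb (z : ℝ) (u : Action) (y : Bool) : ℝ := ∑ a, jointProb z u a y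

/-- The next belief `P(next state = 0 | y)`, by Bayes' rule. -/
def nextBelief (z : ℝ) (u : Action) (y : Bool) : ℝ :=
  (∑ a, if nextState a.2 a.1 y = false then jointProb z u a y else 0) / outProb z u y

/-- Mutual information, in bits, of a probability mass function `q` on a finite product
(with `0 log 0 = 0`). -/
def mutualInfo {A B : Type} [Fintype A] [Fintype B] (q : A → B → ℝ) : ℝ :=
  ∑ a, ∑ b, q a b * Real.logb 2 (q a b / ((∑ b', q a b') * ∑ a', q a' b))

/-- The reward `I(X, S; Y | z, u)`. -/
def reward (z : ℝ) (u : Action) : ℝ := mutualInfo (jointProb z u)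

/-- The quantity maximized in the dynamic programming operator. -/
def bellmanObj (h : ℝ → ℝ) (z : ℝ) (u : Action) : ℝ :=
  reward z u + ∑ y, outProb z u y * h (nextBelief z u y)

/-- The dynamic programming operator `T`. -/
def T (h : ℝ → ℝ) (z : ℝ) : ℝ := ⨆ u : Action, bellmanObj h z u

/-- A policy chooses the next action from the outputs seen so far, most recent output first.
(The initial belief is deterministic, hence need not be listed in the history.) -/
abbrev Policy : Type := List Bool → Action

/-- The belief after the given outputs (most recent first), starting from `z₀`. -/
def beliefAt (z₀ : ℝ) (π : Policy) : List Bool → ℝ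
  | [] => z₀
  | y :: w => nextBelief (beliefAt z₀ π w) (π w) y

/-- The probability of the given outputs (most recent first). -/
def histProb (z₀ : ℝ) (π : Policy) : List Bool → ℝ
  | [] => 1
  | y :: w => histProb z₀ π w * outProb (beliefAt z₀ π w) (π w) y

/-- The expected reward collected after `t` outputs have been observed. -/
def expReward (z₀ : ℝ) (π : Policy) (t : ℕ) : ℝ :=
  ∑ w : Fin t → Bool, histProb z₀ π (List.ofFn w) *
    reward (beliefAt z₀ π (List.ofFn w)) (π (List.ofFn w))

/-- The average reward `ρ_π`. -/
def avgReward (z₀ : ℝ) (π : Policy) : ℝ :=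
  liminf (fun N : ℕ => (∑ t ∈ Finset.range N, expReward z₀ π t) / (N : ℝ)) atTop

/-- The optimal average reward `ρ*`. -/
def optReward (z₀ : ℝ) : ℝ := ⨆ π : Policy, avgReward z₀ π

/-- The belief under the stationary policy `μ` after the given outputs. -/
def stationaryBelief (z₀ : ℝ) (μ : ℝ → Action) : List Bool → ℝ
  | [] => z₀
  | y :: w => nextBelief (stationaryBelief z₀ μ w) (μ (stationaryBelief z₀ μ w)) y

/-- The stationary policy that takes action `μ z` at belief `z`. -/
def stationary (z₀ : ℝ) (μ : ℝ → Action) : Policy := fun w => μ (stationaryBelief z₀ μ w)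

/-! ### The conjectured solution -/

/-- Binary entropy in bits. -/
def H (q : ℝ) : ℝ := Real.binEntropy q / Real.log 2

def b₁ : ℝ := √5 - 2
def b₂ : ℝ := (3 - √5) / 2
def b₃ : ℝ := (√5 - 1) / 2
def b₄ : ℝ := 3 - √5

/-- `log₂` of the golden ratio. -/
def rho : ℝ := Real.logb 2 ((1 + √5) / 2)

def gammaT (z : ℝ) : ℝ :=
  if z ≤ b₂ then (√5 - 1) / 2 * (1 - z) else if z ≤ b₃ then (3 - √5) / 2 else 1 - z

def deltaT (z : ℝ) : ℝ :=
  if z ≤ b₂ then z else if z ≤ b₃ then (3 - √5) / 2 else (√5 - 1) / 2 * z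

/-- The conjectured differential value on `[b₁, b₄]`. -/
def hTilde (z : ℝ) : ℝ :=
  if z ≤ b₂ then H z - rho * z + Real.logb 2 (√5 - 1)
  else if z ≤ b₃ then 1
  else H z + rho * z + Real.logb 2 (3 - √5)

/-- The concave functions on `[0, 1]` that equal `hTilde` on `[b₁, b₄]`. -/
def concaveExtensions : Set (ℝ → ℝ) :=
  {g | ConcaveOn ℝ (Icc 0 1) g ∧ EqOn g hTilde (Icc b₁ b₄)}

/-- The value iterates: `h₀` is the pointwise maximum of the concave extensions of `hTilde`,
and `h_{k+1} = T h_k - rho`. -/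
def hIter : ℕ → ℝ → ℝ
  | 0 => fun z => sSup ((fun g : ℝ → ℝ => g z) '' concaveExtensions)
  | k + 1 => fun z => T (hIter k) z - rho

/-- `h* = limsup h_k`. -/
def hStar (z : ℝ) : ℝ := limsup (fun k => hIter k z) atTop

/-! ### Feedback capacity, for an initial channel state known to encoder and decoder -/

/-- A feedback block code of length `N` with `M` messages. The encoder computes the next input
from the initial state, the message and the past outputs (most recent first); the decoder
estimates the message from the initial state and all `N` outputs (most recent first). -/
structure FeedbackCode (N M : ℕ) where
  enc : Bool → Fin M → List Bool → Bool
  dec : Bool → (Fin N → Bool) → Fin M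

/-- The state of the channel when encoder `e` has been used and the given outputs were seen. -/
def chanState (s₀ : Bool) (e : List Bool → Bool) : List Bool → Bool
  | [] => s₀
  | y :: w => nextState (chanState s₀ e w) (e w) y

/-- The probability of the given outputs when encoder `e` is used. -/
def chanOutProb (s₀ : Bool) (e : List Bool → Bool) : List Bool → ℝ
  | [] => 1
  | y :: w => chanOutProb s₀ e w * channelProb (e w) (chanState s₀ e w) y

/-- The probability of a decoding error when message `m` is sent and the initial state is `s₀`. -/
def FeedbackCode.errorProb {N M : ℕ} (c : FeedbackCode N M) (s₀ : Bool) (m : Fin M) : ℝ :=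
  ∑ y : Fin N → Bool,
    if c.dec s₀ y = m then 0 else chanOutProb s₀ (c.enc s₀ m) (List.ofFn y)

/-- The rate `R` (bits per channel use) is achievable from initial state `s₀`: there are
`(N, ⌈2 ^ (N R)⌉)` codes whose maximal error probability tends to `0`. -/
def IsAchievable (s₀ : Bool) (R : ℝ) : Prop :=
  ∀ ε : ℝ, 0 < ε → ∃ N₀ : ℕ, ∀ N : ℕ, N₀ ≤ N →
    ∃ c : FeedbackCode N ⌈(2 : ℝ) ^ ((N : ℝ) * R)⌉₊, ∀ m, c.errorProb s₀ m ≤ ε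

/-- The feedback capacity, in bits per channel use, from initial state `s₀`. -/
def feedbackCapacity (s₀ : Bool) : ℝ := sSup {R : ℝ | IsAchievable s₀ R}

end

end Trapdoor

open Trapdoor

namespace Trapdoor

noncomputable section

/-! ### Constants and logarithms -/

/-! On `[b₁, b₄]` Bellman's equation can be checked by hand. The conjectured actions lead from this
interval back into it, so there the objective only uses known values of `hTilde`, and
`bracket_hTilde` gives `rho + hTilde`. For the opposite bound, `bracket_hZero_le` replaces the
entropy and both continuation values by supporting lines at the conjectured optimum. The perspective
`p * h (x / p)` turns these lines into functions affine in `δ` and `γ`, and the resulting affine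
bound is at most `rho + hTilde z` on the box. This bound needs only `h ≤ hZero`, the greatest
concave extension.

Since `T` preserves concavity and continuity, every iterate is again a concave extension of `hTilde`
(`hIter_props`). Hence `h₁ ≤ h₀`, and monotonicity of `T` makes the whole sequence decrease. It is
bounded below because from belief `0` a single step reaches `b₁` with probability above `1/2`. The
limit is concave and an infimum of continuous functions, hence continuous up to the endpoints;
Dini's theorem gives uniform convergence, and Bellman's equation passes to the limit
(`bellman_hStar`).

Telescoping `hStar` along any policy bounds its average reward by `rho`. For attainment no maximizer
of `T hStar` off `[b₁, b₄]` is needed: an explicit policy has average reward `rho`, certified by the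
cruder function `potential`, which solves Bellman's inequality for that policy alone.

The capacity is proved independently of the dynamic program. Converse: a fixed output law `testProb`
satisfies `D(P ‖ testProb) ≤ N rho + 1` for the output law `P` of every deterministic feedback
encoder (`divergence_le`), which limits the number of decodable messages (`log_card_le`).
Achievability: a message says at which times to send a ball different from the one in the channel,
never twice in a row. The outputs and the final state determine these times, so Fibonacci-many
messages are sent without error (`exists_zeroError_code`). -/

lemma sqrt_five_sq : (√5 : ℝ) * √5 = 5 := Real.mul_self_sqrt (by norm_num)

lemma sqrt_five_gt : (2.236 : ℝ) < √5 := Real.lt_sqrt_of_sq_lt (by norm_num)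

lemma sqrt_five_lt : √5 < (2.237 : ℝ) := (Real.sqrt_lt' (by norm_num)).2 (by norm_num)

lemma b₃_mul_b₃ : b₃ * b₃ = 1 - b₃ := by
  unfold b₃; nlinarith [sqrt_five_sq]

lemma b₁_eq : b₁ = 2 * b₃ - 1 := by unfold b₁ b₃; ring
lemma b₂_eq : b₂ = 1 - b₃ := by unfold b₂ b₃; ring
lemma b₄_eq : b₄ = 2 - 2 * b₃ := by unfold b₄ b₃; ring
lemma b₃_gt : 0.618 < b₃ := by unfold b₃; linarith [sqrt_five_gt]
lemma b₃_lt : b₃ < 0.6185 := by unfold b₃; linarith [sqrt_five_lt]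
lemma b₃_pos : 0 < b₃ := by linarith [b₃_gt]
lemma b₁_pos : 0 < b₁ := by linarith [b₃_gt, b₁_eq]
lemma b₁_lt_b₂ : b₁ < b₂ := by linarith [b₃_lt, b₁_eq, b₂_eq]
lemma b₂_lt_b₃ : b₂ < b₃ := by linarith [b₃_gt, b₂_eq]
lemma b₃_lt_b₄ : b₃ < b₄ := by linarith [b₃_lt, b₄_eq]
lemma b₄_lt_one : b₄ < 1 := by linarith [b₃_gt, b₄_eq]
lemma b₂_pos : 0 < b₂ := b₁_pos.trans b₁_lt_b₂
lemma b₄_pos : 0 < b₄ := b₃_pos.trans b₃_lt_b₄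
lemma one_sub_b₁ : 1 - b₁ = b₄ := by rw [b₁_eq, b₄_eq]; ring
lemma one_sub_b₂ : 1 - b₂ = b₃ := by rw [b₂_eq]; ring
lemma one_sub_b₃ : 1 - b₃ = b₂ := b₂_eq.symm
lemma one_sub_b₄ : 1 - b₄ = b₁ := by rw [b₁_eq, b₄_eq]; ring

lemma one_sub_mem_Icc {w : ℝ} : w ∈ Icc b₁ b₄ → 1 - w ∈ Icc b₁ b₄ := fun hw =>
  ⟨by linarith [hw.2, one_sub_b₄], by linarith [hw.1, one_sub_b₁]⟩

/-- With `φ` the golden ratio, `b₃ = φ⁻¹`, `b₂ = φ⁻²`, `b₁ = φ⁻³` and `b₄ = 2φ⁻²`. All their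
logarithms are affine in `rho`, which reduces the later entropy identities to linear ones. -/
lemma logb_b₃ : Real.logb 2 b₃ = -rho := by
  have : b₃ = ((1 + √5) / 2)⁻¹ := by
    refine eq_inv_of_mul_eq_one_left ?_
    unfold b₃; nlinarith [sqrt_five_sq]
  rw [this, Real.logb_inv, rho]

lemma logb_b₂ : Real.logb 2 b₂ = -(2 * rho) := by
  have : b₂ = b₃ * b₃ := by rw [b₃_mul_b₃, b₂_eq]
  rw [this, Real.logb_mul b₃_pos.ne' b₃_pos.ne', logb_b₃]; ring

lemma logb_b₁ : Real.logb 2 b₁ = -(3 * rho) := by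
  have : b₁ = b₂ * b₃ := by rw [b₂_eq, b₁_eq]; linarith [b₃_mul_b₃]
  rw [this, Real.logb_mul b₂_pos.ne' b₃_pos.ne', logb_b₃, logb_b₂]; ring

lemma logb_two_mul {x : ℝ} (hx : 0 < x) : Real.logb 2 (2 * x) = 1 + Real.logb 2 x := by
  rw [Real.logb_mul two_ne_zero hx.ne', Real.logb_self_eq_one one_lt_two]

lemma logb_half_mul {x : ℝ} (hx : 0 < x) : Real.logb 2 (x / 2) = Real.logb 2 x - 1 := by
  rw [Real.logb_div hx.ne' two_ne_zero, Real.logb_self_eq_one one_lt_two]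

lemma logb_b₄ : Real.logb 2 b₄ = 1 - 2 * rho := by
  have : b₄ = 2 * b₂ := by rw [b₄_eq, b₂_eq]; ring
  rw [this, logb_two_mul b₂_pos, logb_b₂]; ring

lemma logb_sqrt_five_sub_one : Real.logb 2 (√5 - 1) = 1 - rho := by
  have : √5 - 1 = 2 * b₃ := by unfold b₃; ring
  rw [this, logb_two_mul b₃_pos, logb_b₃]; ring

lemma logb_three_sub_sqrt_five : Real.logb 2 (3 - √5) = 1 - 2 * rho := logb_b₄

lemma rho_pos : 0 < rho := by
  refine Real.logb_pos one_lt_two ?_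
  linarith [sqrt_five_gt]

lemma rho_lt_one : rho < 1 := by
  unfold rho
  rw [Real.logb_lt_iff_lt_rpow one_lt_two (by positivity), Real.rpow_one]
  linarith [sqrt_five_lt]

/-! ### Binary entropy and cross entropy -/

lemma H_eq (q : ℝ) : H q = -(q * Real.logb 2 q) - (1 - q) * Real.logb 2 (1 - q) := by
  simp only [H, Real.binEntropy_eq_negMulLog_add_negMulLog_one_sub, Real.negMulLog, Real.logb]
  ring

lemma H_one_sub (q : ℝ) : H (1 - q) = H q := by simp [H]

lemma continuous_H : Continuous H := by unfold H; fun_prop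

lemma H_nonneg {q : ℝ} (h0 : 0 ≤ q) (h1 : q ≤ 1) : 0 ≤ H q :=
  div_nonneg (Real.binEntropy_nonneg h0 h1) (Real.log_pos one_lt_two).le

lemma H_le_one (q : ℝ) : H q ≤ 1 :=
  (div_le_one (Real.log_pos one_lt_two)).2 Real.binEntropy_le_log_two

lemma H_half : H (1 / 2) = 1 := by
  rw [one_div, H, Real.binEntropy_two_inv, div_self (Real.log_pos one_lt_two).ne']

lemma concaveOn_H : ConcaveOn ℝ (Icc 0 1) H := by
  have := Real.strictConcave_binEntropy.concaveOn.smul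
    (inv_nonneg.2 (Real.log_pos one_lt_two).le)
  refine this.congr fun x _ => ?_
  simp [H, div_eq_inv_mul]

/-- The cross entropy `-w log t - (1 - w) log (1 - t)`, in bits. -/
def crossEntropy (t w : ℝ) : ℝ := -(w * Real.logb 2 t) - (1 - w) * Real.logb 2 (1 - t)

lemma crossEntropy_self (w : ℝ) : crossEntropy w w = H w := (H_eq w).symm

lemma crossEntropy_one_sub (t w : ℝ) : crossEntropy (1 - t) (1 - w) = crossEntropy t w := by
  simp only [crossEntropy, sub_sub_cancel]; ring

lemma mul_logb_sub_le {p q : ℝ} (hp : 0 ≤ p) (hq : 0 < q) :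
    p * (Real.logb 2 q - Real.logb 2 p) ≤ (q - p) / Real.log 2 := by
  rcases hp.eq_or_lt with rfl | hp
  · simpa using div_nonneg hq.le (Real.log_pos one_lt_two).le
  have hl := Real.log_pos one_lt_two
  rw [le_div_iff₀ hl]
  have h := Real.log_le_sub_one_of_pos (div_pos hq hp)
  rw [Real.log_div hq.ne' hp.ne'] at h
  have : p * (Real.logb 2 q - Real.logb 2 p) * Real.log 2 = p * (Real.log q - Real.log p) := by
    simp only [Real.logb]; field_simp
  rw [this]
  have h2 := mul_le_mul_of_nonneg_left h hp.le
  have : p * (q / p - 1) = q - p := by field_simp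
  linarith

/-- Gibbs' inequality. As `crossEntropy q` is affine in its second argument, it is the tangent line
of `H` at `q`; all supporting lines below come from it. -/
lemma H_le_crossEntropy {p q : ℝ} (hp0 : 0 ≤ p) (hp1 : p ≤ 1) (hq0 : 0 < q) (hq1 : q < 1) :
    H p ≤ crossEntropy q p := by
  have h1 := mul_logb_sub_le hp0 hq0
  have h2 := mul_logb_sub_le (sub_nonneg.2 hp1) (sub_pos.2 hq1)
  rw [H_eq, crossEntropy]
  have : (q - p) / Real.log 2 + (1 - q - (1 - p)) / Real.log 2 = 0 := by ring
  nlinarith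

/-! ### The reward and the Bellman objective in the coordinates `δ`, `γ` -/

/-- The bracket in the dynamic programming operator. -/
def bracket (h : ℝ → ℝ) (δ γ : ℝ) : ℝ :=
  H (1 / 2 + (δ - γ) / 2) + δ + γ - 1
    + (1 + δ - γ) / 2 * h (2 * δ / (1 + δ - γ))
    + (1 - δ + γ) / 2 * h (1 - 2 * γ / (1 - δ + γ))

lemma Action.nonneg (u : Action) (s x : Bool) : 0 ≤ u.1 s x := u.2.1 s x

lemma Action.true_eq (u : Action) (s : Bool) : u.1 s true = 1 - u.1 s false := by
  have := u.2.2 s; rw [Fintype.sum_bool] at this; linarith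

lemma Action.false_eq (u : Action) (s : Bool) : u.1 s false = 1 - u.1 s true := by
  have := u.2.2 s; rw [Fintype.sum_bool] at this; linarith

lemma outProb_false (z : ℝ) (u : Action) :
    outProb z u false = (1 + z * u.1 false false - (1 - z) * u.1 true true) / 2 := by
  simp [outProb, jointProb, belief, channelProb, Fintype.sum_prod_type, Action.true_eq u false,
    Action.false_eq u true]
  ring

lemma outProb_true (z : ℝ) (u : Action) :
    outProb z u true = (1 - z * u.1 false false + (1 - z) * u.1 true true) / 2 := by
  simp [outProb, jointProb, belief, channelProb, Fintype.sum_prod_type, Action.true_eq u false,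
    Action.false_eq u true]
  ring

lemma nextBelief_false (z : ℝ) (u : Action) :
    nextBelief z u false = 2 * (z * u.1 false false) /
      (1 + z * u.1 false false - (1 - z) * u.1 true true) := by
  rw [nextBelief, outProb_false]
  simp [jointProb, nextState, belief, channelProb, Fintype.sum_prod_type]
  rw [← mul_div_mul_left _ _ (two_ne_zero (α := ℝ))]
  congr 1 <;> ring

lemma nextBelief_true (z : ℝ) (u : Action) :
    nextBelief z u true = (1 - z * u.1 false false - (1 - z) * u.1 true true) /
      (1 - z * u.1 false false + (1 - z) * u.1 true true) := by
  rw [nextBelief, outProb_true]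
  simp [jointProb, nextState, belief, channelProb, Fintype.sum_prod_type, Action.true_eq u false,
    Action.false_eq u true]
  rw [← mul_div_mul_left _ _ (two_ne_zero (α := ℝ))]
  congr 1 <;> ring

lemma coord_mem {z : ℝ} (hz : z ∈ Icc (0 : ℝ) 1) (u : Action) :
    z * u.1 false false ∈ Icc 0 z ∧ (1 - z) * u.1 true true ∈ Icc 0 (1 - z) := by
  have h1 := u.nonneg false true
  have h2 := u.nonneg true false
  rw [u.true_eq] at h1
  rw [u.false_eq] at h2
  exact ⟨⟨mul_nonneg hz.1 (u.nonneg _ _), mul_le_of_le_one_right hz.1 (by linarith)⟩,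
    ⟨mul_nonneg (sub_nonneg.2 hz.2) (u.nonneg _ _),
      mul_le_of_le_one_right (sub_nonneg.2 hz.2) (by linarith)⟩⟩

/-- The bound `w * c ≤ p` rules out a zero denominator unless `w = 0`, in which case both sides
vanish. -/
lemma mul_logb_weight {w c p : ℝ} (hw : 0 ≤ w) (hc : 0 < c) (hp : w * c ≤ p) :
    w * c * Real.logb 2 (w * c / (w * p)) =
      w * c * (Real.logb 2 c - Real.logb 2 p) := by
  rcases hw.eq_or_lt with rfl | hw
  · simp
  have hp : 0 < p := lt_of_lt_of_le (mul_pos hw hc) hp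
  rw [mul_div_mul_left _ _ hw.ne', Real.logb_div hc.ne' hp.ne']

/-- An action from the two probabilities `p(0|0)` and `p(1|1)`. -/
def mkAction (a b : ℝ) (ha : a ∈ Icc (0 : ℝ) 1) (hb : b ∈ Icc (0 : ℝ) 1) : Action :=
  ⟨fun s x => if s then (if x then b else 1 - b) else (if x then 1 - a else a), by
    refine ⟨fun s x => ?_, fun s => ?_⟩
    · cases s <;> cases x <;> simp [ha.1, ha.2, hb.1, hb.2]
    · cases s <;> simp⟩

lemma exists_action {z δ γ : ℝ} (hδ : δ ∈ Icc 0 z) (hγ : γ ∈ Icc 0 (1 - z)) :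
    ∃ u : Action, z * u.1 false false = δ ∧ (1 - z) * u.1 true true = γ := by
  have aux : ∀ {y d : ℝ}, d ∈ Icc 0 y → d / y ∈ Icc (0 : ℝ) 1 ∧ y * (d / y) = d := by
    intro y d hd
    have hy := hd.1.trans hd.2
    refine ⟨⟨div_nonneg hd.1 hy, div_le_one_of_le₀ hd.2 hy⟩, ?_⟩
    rcases hy.eq_or_lt with rfl | hy
    · simp [le_antisymm hd.2 hd.1]
    · field_simp
  exact ⟨mkAction _ _ (aux hδ).1 (aux hγ).1, by simpa [mkAction] using (aux hδ).2,
    by simpa [mkAction] using (aux hγ).2⟩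

lemma reward_eq {z : ℝ} (hz : z ∈ Icc (0 : ℝ) 1) (u : Action) :
    reward z u = H (1 / 2 + (z * u.1 false false - (1 - z) * u.1 true true) / 2)
      + z * u.1 false false + (1 - z) * u.1 true true - 1 := by
  obtain ⟨⟨hδ0, hδ1⟩, ⟨hγ0, hγ1⟩⟩ := coord_mem hz u
  set δ := z * u.1 false false with hδ
  set γ := (1 - z) * u.1 true true with hγ
  have e1 : z * u.1 false true = z - δ := by rw [hδ, u.true_eq]; ring
  have e2 : (1 - z) * u.1 true false = 1 - z - γ := by rw [hγ, u.false_eq]; ring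
  have hj : ∀ x s y, jointProb z u (x, s) y = belief z s * u.1 s x * channelProb x s y :=
    fun _ _ _ => rfl
  rw [reward, mutualInfo]
  simp only [Fintype.sum_bool, Fintype.sum_prod_type]
  simp only [hj, belief, channelProb, if_true, if_false, e1, e2, ← hδ, ← hγ,
    Bool.true_eq_false, Bool.false_eq_true]
  norm_num only
  simp only [zero_mul, mul_zero, add_zero, zero_add, mul_one]
  have m1 := mul_logb_weight (w := z - δ) (c := 1 / 2) (p := (1 + δ - γ) / 2) (by linarith)
    (by norm_num) (by linarith)
  have m2 := mul_logb_weight (w := z - δ) (c := 1 / 2) (p := (1 - δ + γ) / 2) (by linarith)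
    (by norm_num) (by linarith)
  have m3 := mul_logb_weight (w := 1 - z - γ) (c := 1 / 2) (p := (1 + δ - γ) / 2) (by linarith)
    (by norm_num) (by linarith)
  have m4 := mul_logb_weight (w := 1 - z - γ) (c := 1 / 2) (p := (1 - δ + γ) / 2) (by linarith)
    (by norm_num) (by linarith)
  have m5 := mul_logb_weight (w := δ) (c := 1) (p := (1 + δ - γ) / 2) (by linarith)
    (by norm_num) (by linarith)
  have m6 := mul_logb_weight (w := γ) (c := 1) (p := (1 - δ + γ) / 2) (by linarith)
    (by norm_num) (by linarith)
  simp only [mul_one, Real.logb_one] at m5 m6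
  have hhalf : Real.logb 2 (1 / 2) = -1 := by
    rw [one_div, Real.logb_inv, Real.logb_self_eq_one one_lt_two]
  have es : (z - δ) * (1 / 2) + (z - δ) * (1 / 2) = z - δ := by ring
  have es' : (1 - z - γ) * (1 / 2) + (1 - z - γ) * (1 / 2) = 1 - z - γ := by ring
  have hp0 : (z - δ) * (1 / 2) + ((1 - z - γ) * (1 / 2) + δ) = (1 + δ - γ) / 2 := by ring
  have hp1 : γ + (z - δ) * (1 / 2) + (1 - z - γ) * (1 / 2) = (1 - δ + γ) / 2 := by ring
  rw [es, es', hp0, hp1, m1, m2, m3, m4, m5, m6, hhalf, H_eq,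
    show 1 - (1 / 2 + (δ - γ) / 2) = (1 - δ + γ) / 2 by ring,
    show 1 / 2 + (δ - γ) / 2 = (1 + δ - γ) / 2 by ring]
  ring

lemma bellmanObj_eq (h : ℝ → ℝ) {z : ℝ} (hz : z ∈ Icc (0 : ℝ) 1) (u : Action) :
    bellmanObj h z u = bracket h (z * u.1 false false) ((1 - z) * u.1 true true) := by
  obtain ⟨⟨hδ0, hδ1⟩, ⟨hγ0, hγ1⟩⟩ := coord_mem hz u
  rw [bellmanObj, reward_eq hz, Fintype.sum_bool, outProb_false, outProb_true, nextBelief_false,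
    nextBelief_true, bracket]
  set δ := z * u.1 false false with hδ
  set γ := (1 - z) * u.1 true true with hγ
  -- If output `1` has probability zero, the two sides evaluate `h` at different junk quotients, but
  -- with coefficient `0`.
  rcases eq_or_ne (1 - δ + γ) 0 with h0 | h0
  · rw [h0]; ring
  rw [show 1 - 2 * γ / (1 - δ + γ) = (1 - δ - γ) / (1 - δ + γ) by field_simp; ring]
  ring

lemma T_eq_sSup (h : ℝ → ℝ) {z : ℝ} (hz : z ∈ Icc (0 : ℝ) 1) : T h z =
    sSup {r : ℝ | ∃ δ ∈ Icc 0 z, ∃ γ ∈ Icc 0 (1 - z), r = bracket h δ γ} := by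
  rw [T, iSup]
  congr 1
  ext r
  constructor
  · rintro ⟨u, rfl⟩
    exact ⟨_, (coord_mem hz u).1, _, (coord_mem hz u).2, bellmanObj_eq h hz u⟩
  · rintro ⟨δ, hδ, γ, hγ, rfl⟩
    obtain ⟨u, rfl, rfl⟩ := exists_action hδ hγ
    exact ⟨u, bellmanObj_eq h hz u⟩

/-! ### Elementary properties of the operator `T` -/

/-- The admissible pairs `(δ, γ)` at belief `z`. -/
def box (z : ℝ) : Set (ℝ × ℝ) := {a | a.1 ∈ Icc 0 z ∧ a.2 ∈ Icc 0 (1 - z)}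

lemma next_mem_Icc {δ γ : ℝ} (hδ : 0 ≤ δ) (hγ : 0 ≤ γ) (h : δ + γ ≤ 1) :
    2 * δ / (1 + δ - γ) ∈ Icc (0 : ℝ) 1 ∧ 1 - 2 * γ / (1 - δ + γ) ∈ Icc (0 : ℝ) 1 := by
  have h1 : 0 ≤ 2 * γ / (1 - δ + γ) := div_nonneg (by linarith) (by linarith)
  have h2 : 2 * γ / (1 - δ + γ) ≤ 1 := div_le_one_of_le₀ (by linarith) (by linarith)
  exact ⟨⟨div_nonneg (by linarith) (by linarith), div_le_one_of_le₀ (by linarith) (by linarith)⟩,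
    ⟨by linarith, by linarith⟩⟩

lemma bracket_swap (h : ℝ → ℝ) (δ γ : ℝ) :
    bracket (fun w => h (1 - w)) γ δ = bracket h δ γ := by
  have : H (1 / 2 + (γ - δ) / 2) = H (1 / 2 + (δ - γ) / 2) := by
    rw [← H_one_sub]; congr 1; ring
  simp only [bracket, this, sub_sub_cancel]
  rw [show 1 - γ + δ = 1 + δ - γ by ring, show 1 + γ - δ = 1 - δ + γ by ring]
  ring

section
variable {z δ γ : ℝ} (ha : (δ, γ) ∈ box z)
include ha

lemma box_nonneg : 0 ≤ δ ∧ 0 ≤ γ ∧ δ + γ ≤ 1 :=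
  ⟨ha.1.1, ha.2.1, by linarith [ha.1.2, ha.2.2]⟩

lemma bracket_le_bracket {h g : ℝ → ℝ} {ε : ℝ} (hg : ∀ w ∈ Icc (0 : ℝ) 1, h w ≤ g w + ε) :
    bracket h δ γ ≤ bracket g δ γ + ε := by
  obtain ⟨h1, h2, h3⟩ := box_nonneg ha
  obtain ⟨n1, n2⟩ := next_mem_Icc h1 h2 h3
  have a1 := mul_le_mul_of_nonneg_left (hg _ n1) (show 0 ≤ (1 + δ - γ) / 2 by linarith)
  have a2 := mul_le_mul_of_nonneg_left (hg _ n2) (show 0 ≤ (1 - δ + γ) / 2 by linarith)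
  unfold bracket
  linarith

lemma bracket_le {h : ℝ → ℝ} {B : ℝ} (hB : ∀ w ∈ Icc (0 : ℝ) 1, h w ≤ B) :
    bracket h δ γ ≤ 1 + B := by
  have := bracket_le_bracket ha (h := h) (g := 0) (ε := B) (by simpa using hB)
  obtain ⟨h1, h2, h3⟩ := box_nonneg ha
  simp only [bracket, Pi.zero_apply, mul_zero, add_zero] at this
  have h4 := H_le_one (1 / 2 + (δ - γ) / 2)
  unfold bracket
  linarith

lemma le_T {h : ℝ → ℝ} (hz : z ∈ Icc (0 : ℝ) 1) (hB : ∃ B, ∀ w ∈ Icc (0 : ℝ) 1, h w ≤ B) :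
    bracket h δ γ ≤ T h z := by
  obtain ⟨B, hB⟩ := hB
  rw [T_eq_sSup h hz]
  refine le_csSup ⟨1 + B, ?_⟩ ⟨δ, ha.1, γ, ha.2, rfl⟩
  rintro _ ⟨δ', h1, γ', h2, rfl⟩
  exact bracket_le (z := z) ⟨h1, h2⟩ hB

end

lemma T_le {h : ℝ → ℝ} {z c : ℝ} (hz : z ∈ Icc (0 : ℝ) 1)
    (hc : ∀ δ γ, (δ, γ) ∈ box z → bracket h δ γ ≤ c) : T h z ≤ c := by
  rw [T_eq_sSup h hz]
  refine csSup_le ⟨_, 0, ⟨le_rfl, hz.1⟩, 0, ⟨le_rfl, sub_nonneg.2 hz.2⟩, rfl⟩ ?_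
  rintro _ ⟨δ, h1, γ, h2, rfl⟩
  exact hc δ γ ⟨h1, h2⟩

lemma T_le_T {h g : ℝ → ℝ} {ε z : ℝ} (hz : z ∈ Icc (0 : ℝ) 1)
    (hB : ∃ B, ∀ w ∈ Icc (0 : ℝ) 1, g w ≤ B) (hg : ∀ w ∈ Icc (0 : ℝ) 1, h w ≤ g w + ε) :
    T h z ≤ T g z + ε :=
  T_le hz fun _ _ ha => (bracket_le_bracket ha hg).trans (by gcongr; exact le_T ha hz hB)

/-! ### `T` preserves concavity -/

/-- The perspective `p * h (x / p)`. -/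
def persp (h : ℝ → ℝ) (p x : ℝ) : ℝ := p * h (x / p)

lemma bracket_eq_persp (h : ℝ → ℝ) (δ γ : ℝ) :
    bracket h δ γ = H (1 / 2 + (δ - γ) / 2) + δ + γ - 1 + persp h ((1 + δ - γ) / 2) δ
      + persp (fun w => h (1 - w)) ((1 - δ + γ) / 2) γ := by
  simp only [bracket, persp]
  rw [show δ / ((1 + δ - γ) / 2) = 2 * δ / (1 + δ - γ) by rw [div_div_eq_mul_div, mul_comm],
    show γ / ((1 - δ + γ) / 2) = 2 * γ / (1 - δ + γ) by rw [div_div_eq_mul_div, mul_comm]]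

/-- The perspective is positively homogeneous, so concavity takes the superlinear form and `a + b =
1` is not required. Division by zero is harmless because `p = 0` forces `x = 0`. -/
lemma persp_concave {h : ℝ → ℝ} (hh : ConcaveOn ℝ (Icc 0 1) h) {p x q y a b : ℝ}
    (hx : x ∈ Icc 0 p) (hy : y ∈ Icc 0 q) (ha : 0 ≤ a) (hb : 0 ≤ b) :
    a * persp h p x + b * persp h q y ≤ persp h (a * p + b * q) (a * x + b * y) := by
  have hp := hx.1.trans hx.2
  have hq := hy.1.trans hy.2
  have hap := mul_nonneg ha hp
  have hbq := mul_nonneg hb hq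
  unfold persp
  rcases (add_nonneg hap hbq).eq_or_lt with h0 | h0
  · have e1 : a * p = 0 := by linarith
    have e2 : b * q = 0 := by linarith
    rw [e1, e2, ← mul_assoc, ← mul_assoc, e1, e2]
    simp
  have aux : ∀ {p x : ℝ}, x ∈ Icc 0 p → x / p ∈ Icc (0 : ℝ) 1 ∧ p * (x / p) = x := by
    intro p x hx
    have hp := hx.1.trans hx.2
    refine ⟨⟨div_nonneg hx.1 hp, div_le_one_of_le₀ hx.2 hp⟩, ?_⟩
    rcases hp.eq_or_lt with rfl | hp
    · simp [le_antisymm hx.2 hx.1]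
    · field_simp
  have key := hh.2 (aux hx).1 (aux hy).1 (div_nonneg hap h0.le) (div_nonneg hbq h0.le)
    (by rw [← add_div, div_self h0.ne'])
  simp only [smul_eq_mul] at key
  have e : a * p / (a * p + b * q) * (x / p) + b * q / (a * p + b * q) * (y / q) =
      (a * x + b * y) / (a * p + b * q) := by
    calc _ = (a * (p * (x / p)) + b * (q * (y / q))) / (a * p + b * q) := by ring
      _ = _ := by rw [(aux hx).2, (aux hy).2]
  rw [e] at key
  have := mul_le_mul_of_nonneg_left key h0.le
  refine le_trans (le_of_eq ?_) this
  field_simp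

lemma concaveOn_comp_one_sub {h : ℝ → ℝ} (hh : ConcaveOn ℝ (Icc 0 1) h) :
    ConcaveOn ℝ (Icc 0 1) fun w => h (1 - w) := by
  refine ⟨convex_Icc 0 1, fun x hx y hy a b ha hb hab => ?_⟩
  have := hh.2 (x := 1 - x) (y := 1 - y) ⟨by linarith [hx.2], by linarith [hx.1]⟩
    ⟨by linarith [hy.2], by linarith [hy.1]⟩ ha hb hab
  simp only [smul_eq_mul] at this ⊢
  rwa [show a * (1 - x) + b * (1 - y) = 1 - (a * x + b * y) by linear_combination hab] at this

lemma bracket_concave {h : ℝ → ℝ} (hh : ConcaveOn ℝ (Icc 0 1) h) {z z' δ γ δ' γ' a b : ℝ}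
    (h1 : (δ, γ) ∈ box z) (h2 : (δ', γ') ∈ box z') (ha : 0 ≤ a) (hb : 0 ≤ b) (hab : a + b = 1) :
    a * bracket h δ γ + b * bracket h δ' γ' ≤
      bracket h (a * δ + b * δ') (a * γ + b * γ') := by
  obtain ⟨n1, n2, n3⟩ := box_nonneg h1
  obtain ⟨m1, m2, m3⟩ := box_nonneg h2
  have k1 := persp_concave hh (p := (1 + δ - γ) / 2) (q := (1 + δ' - γ') / 2) (x := δ) (y := δ')
    ⟨n1, by linarith⟩ ⟨m1, by linarith⟩ ha hb
  have k2 := persp_concave (concaveOn_comp_one_sub hh) (p := (1 - δ + γ) / 2)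
    (q := (1 - δ' + γ') / 2) (x := γ) (y := γ') ⟨n2, by linarith⟩ ⟨m2, by linarith⟩ ha hb
  have k3 := concaveOn_H.2 (x := 1 / 2 + (δ - γ) / 2) (y := 1 / 2 + (δ' - γ') / 2)
    ⟨by linarith, by linarith⟩ ⟨by linarith, by linarith⟩ ha hb hab
  simp only [smul_eq_mul] at k3
  rw [show a * ((1 + δ - γ) / 2) + b * ((1 + δ' - γ') / 2) =
    (1 + (a * δ + b * δ') - (a * γ + b * γ')) / 2 by linear_combination hab / 2] at k1
  rw [show a * ((1 - δ + γ) / 2) + b * ((1 - δ' + γ') / 2) =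
    (1 - (a * δ + b * δ') + (a * γ + b * γ')) / 2 by linear_combination hab / 2] at k2
  rw [show a * (1 / 2 + (δ - γ) / 2) + b * (1 / 2 + (δ' - γ') / 2) =
    1 / 2 + ((a * δ + b * δ') - (a * γ + b * γ')) / 2 by linear_combination hab / 2] at k3
  simp only [bracket_eq_persp]
  linear_combination k1 + k2 + k3 - hab

/-- The objective is jointly concave in `(δ, γ)`, and a mixture of admissible pairs at `x` and `y`
is admissible at the mixed belief. This is the gain from the coordinates `δ`, `γ`. -/
lemma concaveOn_T {h : ℝ → ℝ} (hh : ConcaveOn ℝ (Icc 0 1) h)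
    (hB : ∃ B, ∀ w ∈ Icc (0 : ℝ) 1, h w ≤ B) : ConcaveOn ℝ (Icc 0 1) (T h) := by
  refine ⟨convex_Icc 0 1, fun x hx y hy a b ha hb hab => ?_⟩
  have hxy := convex_Icc (0 : ℝ) 1 hx hy ha hb hab
  simp only [smul_eq_mul] at hxy ⊢
  have key : ∀ δ γ, (δ, γ) ∈ box x → ∀ δ' γ', (δ', γ') ∈ box y →
      a * bracket h δ γ + b * bracket h δ' γ' ≤ T h (a * x + b * y) := by
    intro δ γ h1 δ' γ' h2
    refine (bracket_concave hh h1 h2 ha hb hab).trans (le_T ?_ hxy hB)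
    refine ⟨⟨?_, ?_⟩, ⟨?_, ?_⟩⟩
    · have := h1.1.1; have := h2.1.1; positivity
    · exact add_le_add (mul_le_mul_of_nonneg_left h1.1.2 ha) (mul_le_mul_of_nonneg_left h2.1.2 hb)
    · have := h1.2.1; have := h2.2.1; positivity
    · have := mul_le_mul_of_nonneg_left h1.2.2 ha
      have := mul_le_mul_of_nonneg_left h2.2.2 hb
      dsimp only at *
      linarith
  refine le_of_forall_pos_le_add fun ε hε => ?_
  have approx : ∀ z ∈ Icc (0 : ℝ) 1, ∃ δ γ, (δ, γ) ∈ box z ∧ T h z ≤ bracket h δ γ + ε := by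
    intro z hz
    by_contra! hcon
    have := T_le (h := h) (c := T h z - ε) hz fun δ γ hd => by linarith [hcon δ γ hd]
    linarith
  obtain ⟨δ, γ, h1, e1⟩ := approx x hx
  obtain ⟨δ', γ', h2, e2⟩ := approx y hy
  have := key δ γ h1 δ' γ' h2
  have := mul_le_mul_of_nonneg_left e1 ha
  have := mul_le_mul_of_nonneg_left e2 hb
  have : a * ε + b * ε = ε := by rw [← add_mul, hab, one_mul]
  linarith

/-! ### `T` preserves continuity -/

lemma continuous_persp {h : ℝ → ℝ} (hh : Continuous h) {B : ℝ} (hB : ∀ w, |h w| ≤ B) :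
    Continuous fun a : ℝ × ℝ => persp h a.1 a.2 := by
  rw [continuous_iff_continuousAt]
  rintro ⟨p, x⟩
  rcases eq_or_ne p 0 with rfl | hp
  · have : Tendsto (fun a : ℝ × ℝ => |a.1| * B) (nhds ((0 : ℝ), x)) (nhds 0) := by
      have : Continuous fun a : ℝ × ℝ => |a.1| * B := by fun_prop
      simpa using this.tendsto ((0 : ℝ), x)
    simp only [ContinuousAt, persp, zero_mul]
    refine squeeze_zero_norm (fun a => ?_) this
    rw [Real.norm_eq_abs, abs_mul]
    exact mul_le_mul_of_nonneg_left (hB _) (abs_nonneg _)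
  · simp only [ContinuousAt, persp]
    refine Tendsto.mul continuous_fst.continuousAt ((hh.tendsto _).comp ?_)
    exact (continuous_snd.continuousAt).div continuous_fst.continuousAt hp

/-- Rescaling the box by `δ = z a`, `γ = (1 - z) b` gives a supremum of a jointly continuous
function over a fixed compact square. Extending `h` by constants outside `[0, 1]` makes it globally
bounded, which is what makes its perspective continuous at `p = 0`. -/
lemma continuousOn_T {h : ℝ → ℝ} (hh : ContinuousOn h (Icc 0 1)) :
    ContinuousOn (T h) (Icc 0 1) := by
  let g : ℝ → ℝ := IccExtend zero_le_one (domRestrict (Icc 0 1) h)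
  have hg : Continuous g := (continuousOn_iff_continuous_domRestrict.1 hh).Icc_extend'
  have hgh : ∀ w ∈ Icc (0 : ℝ) 1, g w = h w := fun w hw =>
    IccExtend_of_mem zero_le_one _ hw
  obtain ⟨B, hB⟩ := isCompact_Icc.exists_bound_of_continuousOn hh
  have hgB : ∀ w, |g w| ≤ B := fun w => hB _ (projIcc (0 : ℝ) 1 zero_le_one w).2
  have hF : Continuous fun a : ℝ × ℝ => bracket g a.1 a.2 := by
    simp only [bracket_eq_persp]
    have c1 := (continuous_persp hg hgB).comp
      (f := fun a : ℝ × ℝ => ((1 + a.1 - a.2) / 2, a.1)) (by fun_prop)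
    have c2 := (continuous_persp (h := fun w => g (1 - w)) (by fun_prop) (fun w => hgB _)).comp
      (f := fun a : ℝ × ℝ => ((1 - a.1 + a.2) / 2, a.2)) (by fun_prop)
    have c3 : Continuous fun a : ℝ × ℝ => H (1 / 2 + (a.1 - a.2) / 2) + a.1 + a.2 - 1 := by
      have := continuous_H
      fun_prop
    exact (c3.add c1).add c2
  have hK : IsCompact (Icc (0 : ℝ) 1 ×ˢ Icc (0 : ℝ) 1) := isCompact_Icc.prod isCompact_Icc
  have hc := hK.continuous_sSup
    (f := fun (z : ℝ) (a : ℝ × ℝ) => bracket g (z * a.1) ((1 - z) * a.2)) (by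
      exact hF.comp (f := fun b : ℝ × ℝ × ℝ => (b.1 * b.2.1, (1 - b.1) * b.2.2)) (by fun_prop))
  refine hc.continuousOn.congr fun z hz => ?_
  rw [T_eq_sSup h hz]
  congr 1
  have hbr : ∀ δ γ, (δ, γ) ∈ box z → bracket g δ γ = bracket h δ γ := by
    intro δ γ ha
    obtain ⟨h1, h2, h3⟩ := box_nonneg ha
    obtain ⟨n1, n2⟩ := next_mem_Icc h1 h2 h3
    simp only [bracket, hgh _ n1, hgh _ n2]
  ext r
  constructor
  · rintro ⟨δ, hδ, γ, hγ, rfl⟩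
    obtain ⟨u, h1, h2⟩ := exists_action hδ hγ
    have l1 := u.nonneg false true
    have l2 := u.nonneg true false
    rw [u.true_eq] at l1
    rw [u.false_eq] at l2
    refine ⟨(u.1 false false, u.1 true true), ⟨⟨u.nonneg _ _, by linarith⟩,
      ⟨u.nonneg _ _, by linarith⟩⟩, ?_⟩
    dsimp only
    rw [h1, h2, hbr _ _ ⟨hδ, hγ⟩]
  · rintro ⟨⟨a, b⟩, ⟨ha, hb⟩, rfl⟩
    have := coord_mem hz (mkAction a b ha hb)
    simp only [mkAction, if_true, Bool.false_eq_true, if_false] at this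
    exact ⟨_, this.1, _, this.2, hbr _ _ this⟩

/-! ### The greatest concave extension of `hTilde` -/

/-- The affine function that is tangent at `t` to `w ↦ H w - ρ w + 1 - ρ`. -/
def tangentAt (t w : ℝ) : ℝ := crossEntropy t w - rho * w + 1 - rho

/-- The `C¹` extension of `w ↦ H w - ρ w + 1 - ρ` from `[b₁, b₂]` that is affine on either side. -/
def lowerPiece (w : ℝ) : ℝ := tangentAt (max b₁ (min w b₂)) w

/-- The greatest concave extension of `hTilde`. -/
def hZero (w : ℝ) : ℝ := min (lowerPiece w) (lowerPiece (1 - w))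

lemma tangentAt_b₁ (w : ℝ) : tangentAt b₁ w = rho + w := by
  rw [tangentAt, crossEntropy, one_sub_b₁, logb_b₁, logb_b₄]; ring

lemma tangentAt_b₂ (w : ℝ) : tangentAt b₂ w = 1 := by
  rw [tangentAt, crossEntropy, one_sub_b₂, logb_b₂, logb_b₃]; ring

lemma tangentAt_self (w : ℝ) : tangentAt w w = H w - rho * w + 1 - rho := by
  rw [tangentAt, crossEntropy_self]

lemma tangentAt_sub (s t w v : ℝ) : tangentAt t w - tangentAt s w =
    tangentAt t v - tangentAt s v + (v - w) * (Real.logb 2 t - Real.logb 2 s +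
      (Real.logb 2 (1 - s) - Real.logb 2 (1 - t))) := by
  simp only [tangentAt, crossEntropy]; ring

lemma logb_odds_mono {s t : ℝ} (hs : 0 < s) (hst : s ≤ t) (ht : t < 1) :
    0 ≤ Real.logb 2 t - Real.logb 2 s + (Real.logb 2 (1 - s) - Real.logb 2 (1 - t)) := by
  have h1 := Real.logb_le_logb_of_le one_lt_two hs hst
  have h2 := Real.logb_le_logb_of_le one_lt_two (sub_pos.2 ht) (show 1 - t ≤ 1 - s by linarith)
  linarith

lemma clamp_mem (w : ℝ) : max b₁ (min w b₂) ∈ Icc b₁ b₂ :=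
  ⟨le_max_left _ _, max_le b₁_lt_b₂.le (min_le_right _ _)⟩

/-- Thus `lowerPiece` is the minimum of its tangents with contact point in `[b₁, b₂]`, hence
concave. Between the endpoints this is Gibbs' inequality; beyond them it propagates because the
slopes decrease with the contact point. -/
lemma lowerPiece_le {t : ℝ} (ht : t ∈ Icc b₁ b₂) (w : ℝ) : lowerPiece w ≤ tangentAt t w := by
  have ht0 := b₁_pos.trans_le ht.1
  have hb := b₂_lt_b₃.trans (b₃_lt_b₄.trans b₄_lt_one)
  have ht1 := ht.2.trans_lt hb
  have gibbs : ∀ v, 0 ≤ v → v ≤ 1 → 0 ≤ tangentAt t v - tangentAt v v := by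
    intro v h0 h1
    have := H_le_crossEntropy h0 h1 ht0 ht1
    rw [tangentAt_self, tangentAt]; linarith
  rw [lowerPiece]
  rcases le_total w b₁ with h1 | h1
  · rw [max_eq_left ((min_le_left _ _).trans h1)]
    have := tangentAt_sub b₁ t w b₁
    have := gibbs b₁ b₁_pos.le (b₁_lt_b₂.trans hb).le
    have := mul_nonneg (sub_nonneg.2 h1) (logb_odds_mono b₁_pos ht.1 ht1)
    linarith
  rcases le_total w b₂ with h2 | h2
  · rw [min_eq_left h2, max_eq_right h1]
    linarith [gibbs w (b₁_pos.le.trans h1) (h2.trans hb.le)]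
  · rw [min_eq_right h2, max_eq_right b₁_lt_b₂.le]
    have := tangentAt_sub b₂ t w b₂
    have := gibbs b₂ b₂_pos.le hb.le
    have := mul_nonneg (sub_nonneg.2 h2) (logb_odds_mono ht0 ht.2 hb)
    linarith

lemma concaveOn_lowerPiece : ConcaveOn ℝ (Icc 0 1) lowerPiece := by
  refine ⟨convex_Icc 0 1, fun x _ y _ a b ha hb hab => ?_⟩
  simp only [smul_eq_mul]
  have h := clamp_mem (a * x + b * y)
  have h1 := mul_le_mul_of_nonneg_left (lowerPiece_le h x) ha
  have h2 := mul_le_mul_of_nonneg_left (lowerPiece_le h y) hb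
  refine (add_le_add h1 h2).trans (le_of_eq ?_)
  simp only [lowerPiece, tangentAt, crossEntropy]
  linear_combination (1 - rho - Real.logb 2 (1 - max b₁ (min (a * x + b * y) b₂))) * hab

lemma concaveOn_hZero : ConcaveOn ℝ (Icc 0 1) hZero :=
  concaveOn_lowerPiece.inf (concaveOn_comp_one_sub concaveOn_lowerPiece)

lemma continuous_hZero : Continuous hZero := by
  have : Continuous fun w => lowerPiece w := by
    simp only [lowerPiece, tangentAt, crossEntropy, Real.logb]
    have h1 : ∀ w, max b₁ (min w b₂) ≠ 0 := fun w => (b₁_pos.trans_le (clamp_mem w).1).ne'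
    have h2 : ∀ w, 1 - max b₁ (min w b₂) ≠ 0 := fun w => by
      linarith [(clamp_mem w).2, b₂_lt_b₃, b₃_lt_b₄, b₄_lt_one]
    fun_prop (disch := assumption)
  unfold hZero
  fun_prop

lemma hZero_one_sub (w : ℝ) : hZero (1 - w) = hZero w := by
  rw [hZero, hZero, sub_sub_cancel, min_comm]

lemma hZero_le_one (w : ℝ) : hZero w ≤ 1 :=
  (min_le_left _ _).trans ((lowerPiece_le ⟨b₁_lt_b₂.le, le_rfl⟩ w).trans_eq (tangentAt_b₂ w))

lemma hZero_le_add (w : ℝ) : hZero w ≤ rho + w :=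
  (min_le_left _ _).trans ((lowerPiece_le ⟨le_rfl, b₁_lt_b₂.le⟩ w).trans_eq (tangentAt_b₁ w))

lemma hZero_le_sub (w : ℝ) : hZero w ≤ rho + (1 - w) := hZero_one_sub w ▸ hZero_le_add (1 - w)

lemma hZero_le_crossEntropy {t : ℝ} (ht : t ∈ Icc b₃ b₄) (w : ℝ) :
    hZero w ≤ crossEntropy t w + rho * w + 1 - 2 * rho := by
  have h := (min_le_right (lowerPiece w) _).trans (lowerPiece_le (t := 1 - t)
    ⟨by linarith [ht.2, one_sub_b₄], by linarith [ht.1, one_sub_b₃]⟩ (1 - w))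
  rw [tangentAt, crossEntropy_one_sub] at h
  change hZero w ≤ _ at h
  linarith

lemma hTilde_left {z : ℝ} (hz : z ≤ b₂) : hTilde z = H z - rho * z + 1 - rho := by
  rw [hTilde, if_pos hz, logb_sqrt_five_sub_one]; ring

lemma hTilde_mid {z : ℝ} (hz : z ∈ Icc b₂ b₃) : hTilde z = 1 := by
  rcases hz.1.eq_or_lt with rfl | h
  · rw [hTilde_left le_rfl, ← tangentAt_self, tangentAt_b₂]
  · rw [hTilde, if_neg h.not_ge, if_pos hz.2]

lemma hTilde_one_sub {z : ℝ} : hTilde (1 - z) = hTilde z := by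
  have key : ∀ z, z < b₂ → hTilde (1 - z) = hTilde z := by
    intro z h
    rw [hTilde_left h.le, hTilde, if_neg (by linarith [one_sub_b₂, b₂_lt_b₃]),
      if_neg (by linarith [one_sub_b₂]), logb_three_sub_sqrt_five, H_one_sub]
    ring
  rcases lt_or_ge z b₂ with h | h
  · exact key z h
  rcases le_or_gt z b₃ with h' | h'
  · rw [hTilde_mid ⟨h, h'⟩, hTilde_mid ⟨by linarith [one_sub_b₃], by linarith [one_sub_b₂]⟩]
  · have := key (1 - z) (by linarith [one_sub_b₃])
    rw [sub_sub_cancel] at this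
    exact this.symm

lemma hTilde_right {z : ℝ} (hz : b₃ ≤ z) : hTilde z = H z + rho * z + 1 - 2 * rho := by
  rw [← hTilde_one_sub, hTilde_left (by linarith [one_sub_b₃]), H_one_sub]; ring

lemma lowerPiece_of_ge {w : ℝ} (hw : b₂ ≤ w) : lowerPiece w = 1 := by
  rw [lowerPiece, min_eq_right hw, max_eq_right b₁_lt_b₂.le, tangentAt_b₂]

lemma lowerPiece_of_mem {w : ℝ} (hw : w ∈ Icc b₁ b₂) :
    lowerPiece w = H w - rho * w + 1 - rho := by
  rw [lowerPiece, min_eq_left hw.2, max_eq_right hw.1, tangentAt_self]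

lemma hZero_of_le {w : ℝ} (hw : w ≤ b₃) : hZero w = lowerPiece w := by
  rw [hZero, lowerPiece_of_ge (w := 1 - w) (by linarith [one_sub_b₃]), min_eq_left]
  exact (lowerPiece_le ⟨b₁_lt_b₂.le, le_rfl⟩ w).trans_eq (tangentAt_b₂ w)

lemma hZero_eq_of_le {w : ℝ} (hw : w ≤ b₁) : hZero w = rho + w := by
  rw [hZero_of_le (by linarith [b₁_lt_b₂, b₂_lt_b₃]), lowerPiece,
    max_eq_left ((min_le_left _ _).trans hw), tangentAt_b₁]

lemma hZero_eqOn : EqOn hZero hTilde (Icc b₁ b₄) := by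
  have key : ∀ z ∈ Icc b₁ b₃, hZero z = hTilde z := by
    intro z hz
    rw [hZero_of_le hz.2]
    rcases le_total z b₂ with h | h
    · rw [lowerPiece_of_mem ⟨hz.1, h⟩, hTilde_left h]
    · rw [lowerPiece_of_ge h, hTilde_mid ⟨h, hz.2⟩]
  intro z hz
  rcases le_total z b₃ with h | h
  · exact key z ⟨hz.1, h⟩
  · rw [← hZero_one_sub, ← hTilde_one_sub]
    exact key _ ⟨by linarith [hz.2, one_sub_b₄], by linarith [one_sub_b₃, b₂_lt_b₃]⟩

lemma hTilde_b₁ : hTilde b₁ = rho + b₁ := by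
  rw [← hZero_eqOn ⟨le_rfl, by linarith [b₁_lt_b₂, b₂_lt_b₃, b₃_lt_b₄]⟩, hZero_eq_of_le le_rfl]

lemma hasDerivAt_H_b₁ : HasDerivAt (fun z => H z - rho * z + 1 - rho) 1 b₁ := by
  have h := (Real.hasDerivAt_binEntropy (p := b₁) b₁_pos.ne'
    (by linarith [one_sub_b₁, b₄_pos])).div_const (Real.log 2)
  have h2 := ((h.sub ((hasDerivAt_id b₁).const_mul rho)).add_const 1).sub_const rho
  refine h2.congr_deriv ?_
  have e : (Real.log (1 - b₁) - Real.log b₁) / Real.log 2 =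
      Real.logb 2 (1 - b₁) - Real.logb 2 b₁ := by simp only [Real.logb]; ring
  rw [e, one_sub_b₁, logb_b₄, logb_b₁]; ring

/-- By concavity the chord slope left of `b₁` dominates all chord slopes to its right, which tend to
the derivative `1` of `hTilde`. So an extension lies below the tangent line there. -/
lemma extension_le_left {g : ℝ → ℝ} (hg : g ∈ concaveExtensions) {z : ℝ} (h0 : 0 ≤ z)
    (hz : z < b₁) : g z ≤ rho + z := by
  obtain ⟨hc, he⟩ := hg
  have hlt : b₁ < b₄ := by linarith [b₁_lt_b₂, b₂_lt_b₃, b₃_lt_b₄]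
  have hb1 : g b₁ = rho + b₁ := by rw [he ⟨le_rfl, hlt.le⟩, hTilde_b₁]
  have hsl : ∀ w ∈ Ioc b₁ b₂, slope (fun z => H z - rho * z + 1 - rho) b₁ w ≤
      (g b₁ - g z) / (b₁ - z) := by
    intro w hw
    have hw4 : w ≤ b₄ := by linarith [hw.2, b₂_lt_b₃, b₃_lt_b₄]
    have := hc.slope_anti_adjacent (x := z) (y := b₁) (z := w) ⟨h0, by linarith [b₄_lt_one]⟩
      ⟨by linarith [hw.1], by linarith [b₄_lt_one]⟩ hz hw.1
    rw [slope_def_field]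
    rw [he ⟨hw.1.le, hw4⟩, he ⟨le_rfl, hlt.le⟩] at this
    rw [he ⟨le_rfl, hlt.le⟩, hTilde_left b₁_lt_b₂.le]
    rwa [hTilde_left hw.2, hTilde_left b₁_lt_b₂.le] at this
  have ht := (hasDerivAt_iff_tendsto_slope.1 hasDerivAt_H_b₁).mono_left
    (nhdsWithin_mono b₁ (show Ioi b₁ ⊆ {b₁}ᶜ from fun x hx => ne_of_gt hx))
  have h1 : 1 ≤ (g b₁ - g z) / (b₁ - z) :=
    le_of_tendsto ht (Filter.mem_of_superset (Ioc_mem_nhdsGT b₁_lt_b₂) hsl)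
  rw [one_le_div (sub_pos.2 hz)] at h1
  linarith

lemma extension_one_sub {g : ℝ → ℝ} (hg : g ∈ concaveExtensions) :
    (fun w => g (1 - w)) ∈ concaveExtensions :=
  ⟨concaveOn_comp_one_sub hg.1, fun _ hw =>
    (hg.2 (one_sub_mem_Icc hw)).trans hTilde_one_sub⟩

lemma extension_le_hZero {g : ℝ → ℝ} (hg : g ∈ concaveExtensions) {z : ℝ}
    (hz : z ∈ Icc (0 : ℝ) 1) : g z ≤ hZero z := by
  rcases lt_or_ge z b₁ with h | h
  · rw [hZero_eq_of_le h.le]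
    exact extension_le_left hg hz.1 h
  rcases le_or_gt z b₄ with h' | h'
  · rw [hg.2 ⟨h, h'⟩, hZero_eqOn ⟨h, h'⟩]
  · rw [← hZero_one_sub, hZero_eq_of_le (w := 1 - z) (by linarith [one_sub_b₄])]
    have := extension_le_left (extension_one_sub hg) (z := 1 - z) (by linarith [hz.2])
      (by linarith [one_sub_b₄])
    simpa using this

lemma hZero_mem : hZero ∈ concaveExtensions := ⟨concaveOn_hZero, hZero_eqOn⟩

lemma hIter_zero_eqOn : EqOn (hIter 0) hZero (Icc 0 1) := by
  intro z hz
  refine IsGreatest.csSup_eq ⟨⟨hZero, hZero_mem, rfl⟩, ?_⟩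
  rintro _ ⟨g, hg, rfl⟩
  exact extension_le_hZero hg hz

lemma Icc_b_subset : Icc b₁ b₄ ⊆ Icc (0 : ℝ) 1 := Icc_subset_Icc b₁_pos.le b₄_lt_one.le

lemma hIter_zero_mem : hIter 0 ∈ concaveExtensions :=
  ⟨concaveOn_hZero.congr hIter_zero_eqOn.symm,
    (hIter_zero_eqOn.mono Icc_b_subset).trans hZero_eqOn⟩

lemma le_hIter_zero {g : ℝ → ℝ} (hg : g ∈ concaveExtensions) {z : ℝ}
    (hz : z ∈ Icc (0 : ℝ) 1) : g z ≤ hIter 0 z :=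
  (extension_le_hZero hg hz).trans_eq (hIter_zero_eqOn hz).symm

/-! ### Bellman's equation on `[b₁, b₄]` -/

lemma logb_one_add_b₃ : Real.logb 2 (1 + b₃) = rho := by
  have : 1 + b₃ = b₃⁻¹ := by
    refine eq_inv_of_mul_eq_one_left ?_
    linarith [b₃_mul_b₃]
  rw [this, Real.logb_inv, logb_b₃, neg_neg]

/-- The probability of output `0` at belief `z` under the conjectured action on `[b₁, b₂]`. -/
def leftOut (z : ℝ) : ℝ := (1 + z - b₃ * (1 - z)) / 2

section
variable {z : ℝ} (h0 : 0 < z) (h1 : z < 1)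
include h0 h1

lemma leftOut_pos : 0 < leftOut z := by
  unfold leftOut; nlinarith [b₃_lt]

lemma logb_one_sub_leftOut :
    Real.logb 2 (1 - leftOut z) = Real.logb 2 (1 - z) + rho - 1 := by
  have h2 := sub_pos.2 h1
  have h3 : 0 < 1 + b₃ := by linarith [b₃_pos]
  rw [show 1 - leftOut z = ((1 - z) * (1 + b₃)) / 2 by unfold leftOut; ring,
    logb_half_mul (mul_pos h2 h3), Real.logb_mul h2.ne' h3.ne', logb_one_add_b₃]

lemma logb_div_leftOut :
    Real.logb 2 (z / leftOut z) = Real.logb 2 z - Real.logb 2 (leftOut z) :=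
  Real.logb_div h0.ne' (leftOut_pos h0 h1).ne'

lemma logb_one_sub_div_leftOut : Real.logb 2 (1 - z / leftOut z) =
    Real.logb 2 (1 - z) - 2 * rho - 1 - Real.logb 2 (leftOut z) := by
  have h2 := sub_pos.2 h1
  have h3 := leftOut_pos h0 h1
  have : 1 - z / leftOut z = ((1 - z) * b₂) / 2 / leftOut z := by
    field_simp
    unfold leftOut; rw [b₂_eq]; ring
  rw [this, Real.logb_div (by have := b₂_pos; positivity) h3.ne',
    logb_half_mul (mul_pos h2 b₂_pos), Real.logb_mul h2.ne' b₂_pos.ne', logb_b₂]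
  ring

end

lemma left_next_true {z : ℝ} (h1 : z < 1) :
    1 - 2 * (b₃ * (1 - z)) / (1 - z + b₃ * (1 - z)) = b₁ := by
  have h2 := sub_pos.2 h1
  have h3 : 0 < 1 + b₃ := by linarith [b₃_pos]
  have : 1 - z + b₃ * (1 - z) = (1 - z) * (1 + b₃) := by ring
  rw [this, b₁_eq]
  field_simp
  linarith [b₃_mul_b₃]

lemma left_next_false (z : ℝ) : 2 * z / (1 + z - b₃ * (1 - z)) = z / leftOut z := by
  rw [leftOut, div_div_eq_mul_div, mul_comm]

lemma b₃_mul_leftOut (z : ℝ) : b₃ * leftOut z = (b₁ + z) / 2 := by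
  unfold leftOut; rw [b₁_eq]; linear_combination (z - 1) / 2 * b₃_mul_b₃

/-- The belief after output `0` lands in the right piece of `hTilde`; after output `1` it is exactly
`b₁` by `left_next_true`. So the action never leaves `[b₁, b₄]`. -/
lemma div_leftOut_mem {z : ℝ} (hz : z ∈ Icc b₁ b₂) : z / leftOut z ∈ Icc b₃ b₄ := by
  have hq := leftOut_pos (b₁_pos.trans_le hz.1) (z := z)
    (by linarith [hz.2, b₂_lt_b₃, b₃_lt_b₄, b₄_lt_one])
  have e := b₃_mul_leftOut z
  have e4 : b₄ = 2 * (b₃ * b₃) := by rw [b₃_mul_b₃, b₄_eq]; ring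
  refine ⟨(le_div_iff₀ hq).2 (by linarith [hz.1]), (div_le_iff₀ hq).2 ?_⟩
  rw [e4, mul_assoc, mul_assoc, e]
  have : b₃ * b₁ = b₂ * b₂ := by
    rw [b₁_eq, b₂_eq]; linear_combination b₃_mul_b₃
  have h2 := hz.2
  rw [b₂_eq] at h2 this
  nlinarith [b₃_mul_b₃, b₃_lt]

lemma bracket_left {h : ℝ → ℝ} (hh : EqOn h hTilde (Icc b₁ b₄)) {z : ℝ} (hz : z ∈ Icc b₁ b₂) :
    bracket h z (b₃ * (1 - z)) = rho + hTilde z := by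
  have h0 := b₁_pos.trans_le hz.1
  have h1 : z < 1 := by linarith [hz.2, b₂_lt_b₃, b₃_lt_b₄, b₄_lt_one]
  have hw := div_leftOut_mem hz
  have hlt : b₁ < b₃ := b₁_lt_b₂.trans b₂_lt_b₃
  have hq := leftOut_pos h0 h1
  rw [bracket, left_next_true h1, left_next_false z, hh ⟨hlt.le.trans hw.1, hw.2⟩,
    hh ⟨le_rfl, (hlt.trans b₃_lt_b₄).le⟩, hTilde_b₁, hTilde_right hw.1, hTilde_left hz.2,
    show 1 / 2 + (z - b₃ * (1 - z)) / 2 = leftOut z by unfold leftOut; ring,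
    show (1 + z - b₃ * (1 - z)) / 2 = leftOut z by unfold leftOut; ring,
    show (1 - z + b₃ * (1 - z)) / 2 = 1 - leftOut z by unfold leftOut; ring]
  simp only [H_eq]
  rw [logb_one_sub_leftOut h0 h1, logb_div_leftOut h0 h1, logb_one_sub_div_leftOut h0 h1]
  have e : leftOut z * (z / leftOut z) = z := by field_simp
  have e2 : b₃ * (1 - z) + (1 - leftOut z) * b₁ - (1 - leftOut z) = 0 := by
    unfold leftOut; rw [b₁_eq]; linear_combination (1 - z) * b₃_mul_b₃
  linear_combination (Real.logb 2 (1 - z) - Real.logb 2 z - rho - 1) * e + e2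

lemma bracket_mid {h : ℝ → ℝ} (hh : EqOn h hTilde (Icc b₁ b₄)) {z : ℝ} (hz : z ∈ Icc b₂ b₃) :
    bracket h b₂ b₂ = rho + hTilde z := by
  have hlt : b₁ < b₄ := b₁_lt_b₂.trans (b₂_lt_b₃.trans b₃_lt_b₄)
  have e : (2 : ℝ) * b₂ = b₄ := by rw [b₄_eq, b₂_eq]; ring
  rw [hTilde_mid hz, bracket]
  simp only [sub_self, zero_div, add_zero, H_half, add_sub_cancel_right, sub_add_cancel, div_one, e,
    one_sub_b₄]
  rw [hh ⟨le_rfl, hlt.le⟩, hh ⟨hlt.le, le_rfl⟩, hTilde_b₁, ← hTilde_one_sub, one_sub_b₄, hTilde_b₁]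
  linarith [one_sub_b₄]

lemma half_mul_div {x c : ℝ} (h : c = 0 → x = 0) : c / 2 * (2 * x / c) = x := by
  rcases eq_or_ne c 0 with hc | hc
  · rw [hc, h hc]; simp
  · field_simp

/-- The three concave terms are replaced by their tangents at the conjectured outcome: `leftOut z`,
`z / leftOut z` and `b₁`. In the sum `γ` cancels and the coefficient of `δ` is `log ((1 - z) / z) -
rho`, nonnegative exactly because `z ≤ b₂`; hence `δ = z` is best. -/
lemma bracket_hZero_le_left {z δ γ : ℝ} (hz : z ∈ Icc b₁ b₂) (ha : (δ, γ) ∈ box z) :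
    bracket hZero δ γ ≤ rho + hTilde z := by
  have h0 := b₁_pos.trans_le hz.1
  have hb : b₂ < 1 := b₂_lt_b₃.trans (b₃_lt_b₄.trans b₄_lt_one)
  have h1 : z < 1 := hz.2.trans_lt hb
  obtain ⟨n1, n2, n3⟩ := box_nonneg ha
  have hq := leftOut_pos h0 h1
  have hq1 : leftOut z < 1 := by
    unfold leftOut; nlinarith [b₃_pos]
  have k1 := H_le_crossEntropy (p := 1 / 2 + (δ - γ) / 2) (by linarith) (by linarith) hq hq1
  have k2 := mul_le_mul_of_nonneg_left
    (hZero_le_crossEntropy (div_leftOut_mem hz) (2 * δ / (1 + δ - γ)))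
    (show 0 ≤ (1 + δ - γ) / 2 by linarith)
  have k3 := mul_le_mul_of_nonneg_left (hZero_le_add (1 - 2 * γ / (1 - δ + γ)))
    (show 0 ≤ (1 - δ + γ) / 2 by linarith)
  have e1 : (1 + δ - γ) / 2 * (2 * δ / (1 + δ - γ)) = δ := half_mul_div fun h => by linarith
  have e2 : (1 - δ + γ) / 2 * (2 * γ / (1 - δ + γ)) = γ := half_mul_div fun h => by linarith
  have hmono : 0 ≤ (z - δ) * (Real.logb 2 (1 - z) - Real.logb 2 z - rho) := by
    refine mul_nonneg (sub_nonneg.2 ha.1.2) ?_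
    have := logb_odds_mono h0 hz.2 hb
    rw [one_sub_b₂, logb_b₂, logb_b₃] at this
    linarith
  simp only [crossEntropy] at k1 k2
  rw [logb_one_sub_leftOut h0 h1] at k1
  rw [logb_div_leftOut h0 h1, logb_one_sub_div_leftOut h0 h1] at k2
  rw [bracket, hTilde_left hz.2, H_eq z]
  linear_combination k1 + k2 + k3 + hmono - e2 +
    (Real.logb 2 (1 - z) - Real.logb 2 z - rho - 1) * e1

lemma bracket_hZero_le_mid {z δ γ : ℝ} (ha : (δ, γ) ∈ box z) : bracket hZero δ γ ≤ rho + 1 := by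
  obtain ⟨n1, n2, n3⟩ := box_nonneg ha
  have k1 := H_le_one (1 / 2 + (δ - γ) / 2)
  have k2 := mul_le_mul_of_nonneg_left (hZero_le_sub (2 * δ / (1 + δ - γ)))
    (show 0 ≤ (1 + δ - γ) / 2 by linarith)
  have k3 := mul_le_mul_of_nonneg_left (hZero_le_add (1 - 2 * γ / (1 - δ + γ)))
    (show 0 ≤ (1 - δ + γ) / 2 by linarith)
  have e1 : (1 + δ - γ) / 2 * (2 * δ / (1 + δ - γ)) = δ := half_mul_div fun h => by linarith
  have e2 : (1 - δ + γ) / 2 * (2 * γ / (1 - δ + γ)) = γ := half_mul_div fun h => by linarith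
  rw [bracket]
  linear_combination k1 + k2 + k3 - e1 - e2

lemma box_swap {z δ γ : ℝ} (ha : (δ, γ) ∈ box z) : (γ, δ) ∈ box (1 - z) :=
  ⟨ha.2, by rw [sub_sub_cancel]; exact ha.1⟩

lemma bracket_hZero_le {z δ γ : ℝ} (hz : z ∈ Icc b₁ b₄) (ha : (δ, γ) ∈ box z) :
    bracket hZero δ γ ≤ rho + hTilde z := by
  rcases le_total z b₂ with h | h
  · exact bracket_hZero_le_left ⟨hz.1, h⟩ ha
  rcases le_total z b₃ with h' | h'
  · rw [hTilde_mid ⟨h, h'⟩]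
    exact bracket_hZero_le_mid ha
  · rw [← bracket_swap, ← hTilde_one_sub, funext hZero_one_sub]
    exact bracket_hZero_le_left ⟨by linarith [hz.2, one_sub_b₄], by linarith [one_sub_b₃]⟩
      (box_swap ha)

lemma box_left {z : ℝ} (hz : z ∈ Icc (0 : ℝ) 1) : (z, b₃ * (1 - z)) ∈ box z := by
  have h1 := sub_nonneg.2 hz.2
  exact ⟨⟨hz.1, le_rfl⟩, ⟨mul_nonneg b₃_pos.le h1,
    mul_le_of_le_one_left h1 (b₃_lt_b₄.trans b₄_lt_one).le⟩⟩

lemma hTilde_box {z : ℝ} (hz : z ∈ Icc b₁ b₄) : (deltaT z, gammaT z) ∈ box z := by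
  have hz01 := Icc_b_subset hz
  have e3 : (√5 - 1) / 2 = b₃ := rfl
  have e2 : (3 - √5) / 2 = b₂ := rfl
  unfold deltaT gammaT
  rw [e2, e3]
  split_ifs with h h'
  · exact box_left hz01
  · exact ⟨⟨b₂_pos.le, (not_le.1 h).le⟩, ⟨b₂_pos.le, by linarith [one_sub_b₃]⟩⟩
  · have := box_swap (box_left (z := 1 - z) ⟨by linarith [hz01.2], by linarith [hz01.1]⟩)
    simpa using this

lemma bracket_hTilde {h : ℝ → ℝ} (hh : EqOn h hTilde (Icc b₁ b₄)) {z : ℝ} (hz : z ∈ Icc b₁ b₄) :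
    bracket h (deltaT z) (gammaT z) = rho + hTilde z := by
  have e3 : (√5 - 1) / 2 = b₃ := rfl
  have e2 : (3 - √5) / 2 = b₂ := rfl
  unfold deltaT gammaT
  rw [e2, e3]
  split_ifs with h2 h3
  · exact bracket_left hh ⟨hz.1, h2⟩
  · exact bracket_mid hh ⟨(not_le.1 h2).le, h3⟩
  · rw [← bracket_swap, ← hTilde_one_sub]
    have := bracket_left (h := fun w => h (1 - w)) (z := 1 - z)
      (fun _ hw => (hh (one_sub_mem_Icc hw)).trans hTilde_one_sub)
      ⟨by linarith [hz.2, one_sub_b₄], by linarith [one_sub_b₃, not_le.1 h3]⟩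
    rwa [sub_sub_cancel] at this

/-! ### Convergence of the value iterates -/

lemma exists_le_of_continuousOn {h : ℝ → ℝ} (hh : ContinuousOn h (Icc 0 1)) :
    ∃ B, ∀ w ∈ Icc (0 : ℝ) 1, h w ≤ B := by
  obtain ⟨B, hB⟩ := isCompact_Icc.exists_bound_of_continuousOn hh
  exact ⟨B, fun w hw => (le_abs_self _).trans (hB w hw)⟩

/-- Nothing is assumed about `h` off `[b₁, b₄]` beyond continuity and domination by `hZero`, so the
identity applies to every iterate. -/
lemma T_eq_of_le {h : ℝ → ℝ} (hc : ContinuousOn h (Icc 0 1))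
    (hle : ∀ w ∈ Icc (0 : ℝ) 1, h w ≤ hZero w) (he : EqOn h hTilde (Icc b₁ b₄)) {z : ℝ}
    (hz : z ∈ Icc b₁ b₄) : T h z = rho + hTilde z := by
  refine le_antisymm (T_le (Icc_b_subset hz) fun δ γ ha => ?_) ?_
  · have := bracket_le_bracket ha (h := h) (g := hZero) (ε := 0) (by simpa using hle)
    linarith [bracket_hZero_le hz ha]
  · rw [← bracket_hTilde he hz]
    exact le_T (hTilde_box hz) (Icc_b_subset hz) (exists_le_of_continuousOn hc)

lemma hIter_props (k : ℕ) : ContinuousOn (hIter k) (Icc 0 1) ∧ hIter k ∈ concaveExtensions := by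
  induction k with
  | zero => exact ⟨continuous_hZero.continuousOn.congr hIter_zero_eqOn, hIter_zero_mem⟩
  | succ k ih =>
    obtain ⟨hc, hm⟩ := ih
    refine ⟨(continuousOn_T hc).sub continuousOn_const, ?_, fun z hz => ?_⟩
    · exact (concaveOn_T hm.1 (exists_le_of_continuousOn hc)).sub (convexOn_const _ (convex_Icc _ _))
    · change T (hIter k) z - rho = _
      rw [T_eq_of_le hc (fun w hw => extension_le_hZero hm hw) hm.2 hz]
      ring

lemma exists_hIter_le (k : ℕ) : ∃ B, ∀ w ∈ Icc (0 : ℝ) 1, hIter k w ≤ B :=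
  exists_le_of_continuousOn (hIter_props k).1

lemma hIter_succ_le (k : ℕ) : ∀ z ∈ Icc (0 : ℝ) 1, hIter (k + 1) z ≤ hIter k z := by
  induction k with
  | zero => exact fun z hz => le_hIter_zero (hIter_props 1).2 hz
  | succ k ih =>
    intro z hz
    have := T_le_T (ε := 0) hz (exists_hIter_le k) (by simpa using ih)
    change T (hIter (k + 1)) z - rho ≤ T (hIter k) z - rho
    linarith

lemma hIter_antitone {z : ℝ} (hz : z ∈ Icc (0 : ℝ) 1) : Antitone fun k => hIter k z :=
  antitone_nat_of_succ_le fun k => hIter_succ_le k z hz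

lemma hIter_one_sub (k : ℕ) : ∀ z ∈ Icc (0 : ℝ) 1, hIter k (1 - z) = hIter k z := by
  induction k with
  | zero =>
    intro z hz
    rw [hIter_zero_eqOn hz, hIter_zero_eqOn ⟨by linarith [hz.2], by linarith [hz.1]⟩, hZero_one_sub]
  | succ k ih =>
    have key : ∀ z ∈ Icc (0 : ℝ) 1, T (hIter k) (1 - z) ≤ T (hIter k) z := by
      intro z hz
      refine T_le ⟨by linarith [hz.2], by linarith [hz.1]⟩ fun δ γ ha => ?_
      have hs := box_swap ha
      rw [sub_sub_cancel] at hs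
      rw [← bracket_swap]
      have := bracket_le_bracket hs (h := fun w => hIter k (1 - w)) (g := hIter k) (ε := 0)
        fun w hw => by simp [ih w hw]
      linarith [le_T hs hz (exists_hIter_le k)]
    intro z hz
    have h1 := key z hz
    have h2 := key (1 - z) ⟨by linarith [hz.2], by linarith [hz.1]⟩
    rw [sub_sub_cancel] at h2
    change T (hIter k) (1 - z) - rho = T (hIter k) z - rho
    linarith

/-- From belief `0` the action `(0, b₃)` stays at `0` with probability `(1 - b₃) / 2 < 1/5` and
otherwise moves to `b₁`, whose value is nonnegative. The recursion therefore contracts, and `-4` is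
a comfortable invariant. -/
lemma hIter_zero_ge (k : ℕ) : -4 ≤ hIter k 0 := by
  have h01 : (0 : ℝ) ∈ Icc (0 : ℝ) 1 := ⟨le_rfl, zero_le_one⟩
  induction k with
  | zero =>
    rw [hIter_zero_eqOn h01, hZero_eq_of_le b₁_pos.le]
    linarith [rho_pos]
  | succ k ih =>
    have h := le_T (box_left h01) h01 (exists_hIter_le k)
    have hb : b₁ ≤ b₄ := (b₁_lt_b₂.trans (b₂_lt_b₃.trans b₃_lt_b₄)).le
    have e : 1 - 2 * b₃ / (1 + b₃) = b₁ := by simpa using left_next_true zero_lt_one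
    simp only [bracket, sub_zero, mul_one, add_zero, mul_zero, zero_div, zero_sub, e] at h
    rw [(hIter_props k).2.2 ⟨le_rfl, hb⟩, hTilde_b₁] at h
    have h4 := H_nonneg (q := 1 / 2 + -b₃ / 2) (by linarith [b₃_lt]) (by linarith [b₃_gt])
    change -4 ≤ T (hIter k) 0 - rho
    have h5 : 0 ≤ (1 + b₃) / 2 * (rho + b₁) := by
      have := b₃_pos; have := b₁_pos; have := rho_pos; positivity
    have h6 : (1 + -b₃) / 2 * -4 ≤ (1 + -b₃) / 2 * hIter k 0 :=
      mul_le_mul_of_nonneg_left ih (by linarith [b₃_lt])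
    linarith [rho_lt_one, b₃_gt]

lemma hIter_ge (k : ℕ) : ∀ z ∈ Icc (0 : ℝ) 1, -4 ≤ hIter k z := by
  intro z hz
  have h01 : (0 : ℝ) ∈ Icc (0 : ℝ) 1 := ⟨le_rfl, zero_le_one⟩
  have h11 : (1 : ℝ) ∈ Icc (0 : ℝ) 1 := ⟨zero_le_one, le_rfl⟩
  have h := (hIter_props k).2.1.2 h01 h11 (sub_nonneg.2 hz.2) hz.1 (by ring)
  have h1 : hIter k 1 = hIter k 0 := by simpa using hIter_one_sub k 0 h01
  simp only [smul_eq_mul, mul_zero, mul_one, zero_add, h1] at h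
  linarith [hIter_zero_ge k]

lemma tendsto_hIter {z : ℝ} (hz : z ∈ Icc (0 : ℝ) 1) :
    Tendsto (fun k => hIter k z) atTop (nhds (hStar z)) := by
  have := tendsto_atTop_ciInf (hIter_antitone hz)
    ⟨-4, by rintro _ ⟨k, rfl⟩; exact hIter_ge k z hz⟩
  rw [hStar, this.limsup_eq]
  exact this

lemma hStar_le_hIter (k : ℕ) {z : ℝ} (hz : z ∈ Icc (0 : ℝ) 1) : hStar z ≤ hIter k z :=
  (hIter_antitone hz).le_of_tendsto (tendsto_hIter hz) k

lemma hStar_ge {z : ℝ} (hz : z ∈ Icc (0 : ℝ) 1) : -4 ≤ hStar z :=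
  ge_of_tendsto' (tendsto_hIter hz) fun k => hIter_ge k z hz

lemma hStar_le_one {z : ℝ} (hz : z ∈ Icc (0 : ℝ) 1) : hStar z ≤ 1 :=
  (hStar_le_hIter 0 hz).trans ((hIter_zero_eqOn hz).trans_le (hZero_le_one z))

lemma hStar_eqOn : EqOn hStar hTilde (Icc b₁ b₄) := fun _ hz =>
  tendsto_nhds_unique (tendsto_hIter (Icc_b_subset hz))
    (tendsto_const_nhds.congr fun k => ((hIter_props k).2.2 hz).symm)

lemma hStar_one_sub {z : ℝ} (hz : z ∈ Icc (0 : ℝ) 1) : hStar (1 - z) = hStar z := by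
  simp only [hStar, hIter_one_sub _ z hz]

lemma concaveOn_hStar : ConcaveOn ℝ (Icc 0 1) hStar := by
  refine ⟨convex_Icc 0 1, fun x hx y hy a b ha hb hab => ?_⟩
  exact le_of_tendsto_of_tendsto'
    (((tendsto_hIter hx).const_smul a).add ((tendsto_hIter hy).const_smul b))
    (tendsto_hIter (convex_Icc _ _ hx hy ha hb hab))
    fun k => (hIter_props k).2.1.2 hx hy ha hb hab

/-- Lower semicontinuity comes from the chord of a concave function, upper semicontinuity from
`hStar` being an infimum of continuous iterates. -/
lemma continuousWithinAt_hStar_zero : ContinuousWithinAt hStar (Icc 0 1) 0 := by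
  have h01 : (0 : ℝ) ∈ Icc (0 : ℝ) 1 := ⟨le_rfl, zero_le_one⟩
  have h11 : (1 : ℝ) ∈ Icc (0 : ℝ) 1 := ⟨zero_le_one, le_rfl⟩
  rw [ContinuousWithinAt, tendsto_order]
  constructor
  · intro a ha
    have hlow : ContinuousWithinAt (fun z : ℝ => (1 - z) * hStar 0 + z * hStar 1) (Icc 0 1) 0 := by
      fun_prop
    have := hlow.tendsto.eventually (lt_mem_nhds (a := a) (by simpa using ha))
    filter_upwards [this, self_mem_nhdsWithin] with z h1 hz
    have h := concaveOn_hStar.2 h01 h11 (sub_nonneg.2 hz.2) hz.1 (by ring)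
    simp only [smul_eq_mul, mul_zero, mul_one, zero_add] at h
    exact h1.trans_le h
  · intro a ha
    obtain ⟨k, hk⟩ := ((tendsto_hIter h01).eventually (gt_mem_nhds ha)).exists
    have := ((hIter_props k).1 0 h01).tendsto.eventually (gt_mem_nhds hk)
    filter_upwards [this, self_mem_nhdsWithin] with z h1 hz
    exact (hStar_le_hIter k hz).trans_lt h1

lemma continuousOn_hStar : ContinuousOn hStar (Icc 0 1) := by
  intro z hz
  rcases hz.1.eq_or_lt with rfl | h0
  · exact continuousWithinAt_hStar_zero
  rcases hz.2.eq_or_lt with rfl | h1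
  · have h : ContinuousWithinAt (fun z => hStar (1 - z)) (Icc 0 1) 1 := by
      have h0 : ContinuousWithinAt hStar (Icc 0 1) (1 - 1) := by
        simpa using continuousWithinAt_hStar_zero
      have hf : ContinuousWithinAt (fun z : ℝ => 1 - z) (Icc 0 1) 1 := by fun_prop
      exact h0.comp hf fun z hz => ⟨by linarith [hz.2], by linarith [hz.1]⟩
    exact h.congr (fun z hz => (hStar_one_sub hz).symm) (hStar_one_sub hz).symm
  · have h := concaveOn_hStar.continuousOn_interior
    rw [interior_Icc] at h
    exact (h.continuousAt (Ioo_mem_nhds h0 h1)).continuousWithinAt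

lemma tendstoUniformlyOn_hIter : TendstoUniformlyOn hIter hStar atTop (Icc 0 1) :=
  Antitone.tendstoUniformlyOn_of_forall_tendsto isCompact_Icc (fun k => (hIter_props k).1)
    (fun _ hz => hIter_antitone hz) continuousOn_hStar fun _ hz => tendsto_hIter hz

lemma bellman_hStar {z : ℝ} (hz : z ∈ Icc (0 : ℝ) 1) : rho + hStar z = T hStar z := by
  have hB : ∃ B, ∀ w ∈ Icc (0 : ℝ) 1, hStar w ≤ B := ⟨1, fun w hw => hStar_le_one hw⟩
  refine le_antisymm (le_of_forall_pos_le_add fun ε hε => ?_)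
    (T_le hz fun δ γ ha => ?_)
  · obtain ⟨k, hk⟩ := (Metric.tendstoUniformlyOn_iff.1 tendstoUniformlyOn_hIter ε hε).exists
    have h1 : T (hIter k) z ≤ T hStar z + ε := by
      refine T_le_T hz hB fun w hw => ?_
      have := hk w hw
      rw [dist_comm, Real.dist_eq] at this
      linarith [le_abs_self (hIter k w - hStar w)]
    have h2 : hStar z ≤ T (hIter k) z - rho := hStar_le_hIter (k + 1) hz
    linarith
  · have : ∀ k, bracket hStar δ γ ≤ rho + hIter (k + 1) z := by
      intro k
      have h1 := bracket_le_bracket ha (h := hStar) (g := hIter k) (ε := 0)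
        fun w hw => by simpa using hStar_le_hIter k hw
      have h2 := le_T ha hz (exists_hIter_le k)
      change _ ≤ rho + (T (hIter k) z - rho)
      linarith
    exact ge_of_tendsto' (((tendsto_hIter hz).comp (tendsto_add_atTop_nat 1)).const_add rho) this

/-! ### Optimal average reward -/

lemma sum_ofFn_succ (t : ℕ) (G : List Bool → ℝ) :
    ∑ w : Fin (t + 1) → Bool, G (List.ofFn w) =
      ∑ w : Fin t → Bool, ∑ y, G (y :: List.ofFn w) := by
  rw [← (Fin.consEquiv fun _ : Fin (t + 1) => Bool).sum_comp, Fintype.sum_prod_type,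
    Finset.sum_comm]
  refine Finset.sum_congr rfl fun w _ => Finset.sum_congr rfl fun y _ => ?_
  simp [List.ofFn_succ, Fin.consEquiv]

section
variable {z : ℝ} (hz : z ∈ Icc (0 : ℝ) 1) (u : Action)
include hz

lemma outProb_nonneg (y : Bool) : 0 ≤ outProb z u y := by
  obtain ⟨⟨h1, h2⟩, ⟨h3, h4⟩⟩ := coord_mem hz u
  cases y
  · rw [outProb_false]; linarith
  · rw [outProb_true]; linarith

lemma nextBelief_mem (y : Bool) : nextBelief z u y ∈ Icc (0 : ℝ) 1 := by
  obtain ⟨⟨h1, h2⟩, ⟨h3, h4⟩⟩ := coord_mem hz u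
  cases y
  · rw [nextBelief_false]
    exact (next_mem_Icc h1 h3 (by linarith)).1
  · rw [nextBelief_true]
    exact ⟨div_nonneg (by linarith) (by linarith), div_le_one_of_le₀ (by linarith) (by linarith)⟩

lemma reward_ge : -1 ≤ reward z u := by
  obtain ⟨⟨h1, h2⟩, ⟨h3, h4⟩⟩ := coord_mem hz u
  rw [reward_eq hz]
  have := H_nonneg (q := 1 / 2 + (z * u.1 false false - (1 - z) * u.1 true true) / 2)
    (by linarith) (by linarith)
  linarith

end

lemma sum_outProb (z : ℝ) (u : Action) : ∑ y, outProb z u y = 1 := by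
  rw [Fintype.sum_bool, outProb_true, outProb_false]; ring

lemma beliefAt_mem {z₀ : ℝ} (hz : z₀ ∈ Icc (0 : ℝ) 1) (π : Policy) (w : List Bool) :
    beliefAt z₀ π w ∈ Icc (0 : ℝ) 1 := by
  induction w with
  | nil => exact hz
  | cons y w ih => exact nextBelief_mem ih _ y

lemma histProb_nonneg {z₀ : ℝ} (hz : z₀ ∈ Icc (0 : ℝ) 1) (π : Policy) (w : List Bool) :
    0 ≤ histProb z₀ π w := by
  induction w with
  | nil => exact zero_le_one
  | cons y w ih => exact mul_nonneg ih (outProb_nonneg (beliefAt_mem hz π w) _ y)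

lemma sum_histProb (z₀ : ℝ) (π : Policy) (t : ℕ) :
    ∑ w : Fin t → Bool, histProb z₀ π (List.ofFn w) = 1 := by
  induction t with
  | zero => simp [histProb]
  | succ t ih =>
    rw [sum_ofFn_succ, ← ih]
    refine Finset.sum_congr rfl fun w _ => ?_
    simp only [histProb]
    rw [← Finset.mul_sum, sum_outProb, mul_one]

/-- The expected value of the potential `f` at the belief after `t` outputs. -/
def expPotential (f : ℝ → ℝ) (z₀ : ℝ) (π : Policy) (t : ℕ) : ℝ :=
  ∑ w : Fin t → Bool, histProb z₀ π (List.ofFn w) * f (beliefAt z₀ π (List.ofFn w))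

/-- The telescoping step of both verification bounds: reward plus next potential averages to the
Bellman objective. -/
lemma expReward_add_expPotential (f : ℝ → ℝ) (z₀ : ℝ) (π : Policy) (t : ℕ) :
    expReward z₀ π t + expPotential f z₀ π (t + 1) =
      ∑ w : Fin t → Bool, histProb z₀ π (List.ofFn w) *
        bellmanObj f (beliefAt z₀ π (List.ofFn w)) (π (List.ofFn w)) := by
  rw [expPotential, sum_ofFn_succ t fun w => histProb z₀ π w * f (beliefAt z₀ π w), expReward,
    ← Finset.sum_add_distrib]
  refine Finset.sum_congr rfl fun w _ => ?_
  simp only [histProb, beliefAt, bellmanObj]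
  rw [mul_add, Finset.mul_sum]
  simp only [mul_assoc]

section
variable {z₀ : ℝ} (hz : z₀ ∈ Icc (0 : ℝ) 1) (π : Policy)
include hz

lemma expPotential_mono {f g : ℝ → ℝ} (h : ∀ z ∈ Icc (0 : ℝ) 1, f z ≤ g z) (t : ℕ) :
    expPotential f z₀ π t ≤ expPotential g z₀ π t :=
  Finset.sum_le_sum fun _ _ => mul_le_mul_of_nonneg_left (h _ (beliefAt_mem hz π _))
    (histProb_nonneg hz π _)

omit hz in
lemma expPotential_const (c : ℝ) (t : ℕ) : expPotential (fun _ => c) z₀ π t = c := by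
  rw [expPotential, ← Finset.sum_mul, sum_histProb, one_mul]

omit hz in
lemma expPotential_add_const (f : ℝ → ℝ) (c : ℝ) (t : ℕ) :
    expPotential (fun z => c + f z) z₀ π t = c + expPotential f z₀ π t := by
  simp only [expPotential, mul_add, Finset.sum_add_distrib]
  rw [← Finset.sum_mul, sum_histProb, one_mul]

lemma sum_expReward_le {f : ℝ → ℝ} {c : ℝ}
    (hf : ∀ z ∈ Icc (0 : ℝ) 1, ∀ u, bellmanObj f z u ≤ c + f z) (N : ℕ) :
    ∑ t ∈ Finset.range N, expReward z₀ π t + expPotential f z₀ π N ≤ N * c + f z₀ := by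
  induction N with
  | zero => simp [expPotential, histProb, beliefAt]
  | succ N ih =>
    rw [Finset.sum_range_succ, add_assoc, expReward_add_expPotential]
    have : ∑ w : Fin N → Bool, histProb z₀ π (List.ofFn w) *
        bellmanObj f (beliefAt z₀ π (List.ofFn w)) (π (List.ofFn w)) ≤
          expPotential (fun z => c + f z) z₀ π N :=
      Finset.sum_le_sum fun _ _ => mul_le_mul_of_nonneg_left (hf _ (beliefAt_mem hz π _) _)
        (histProb_nonneg hz π _)
    rw [expPotential_add_const] at this
    push_cast
    linarith

lemma le_sum_expReward {f : ℝ → ℝ} {c : ℝ}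
    (hf : ∀ w, c + f (beliefAt z₀ π w) ≤ bellmanObj f (beliefAt z₀ π w) (π w)) (N : ℕ) :
    N * c + f z₀ ≤ ∑ t ∈ Finset.range N, expReward z₀ π t + expPotential f z₀ π N := by
  induction N with
  | zero => simp [expPotential, histProb, beliefAt]
  | succ N ih =>
    rw [Finset.sum_range_succ, add_assoc, expReward_add_expPotential]
    have : expPotential (fun z => c + f z) z₀ π N ≤ ∑ w : Fin N → Bool,
        histProb z₀ π (List.ofFn w) *
          bellmanObj f (beliefAt z₀ π (List.ofFn w)) (π (List.ofFn w)) :=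
      Finset.sum_le_sum fun _ _ => mul_le_mul_of_nonneg_left (hf _) (histProb_nonneg hz π _)
    rw [expPotential_add_const] at this
    push_cast
    linarith

lemma bellmanObj_hStar_le : ∀ u, bellmanObj hStar z₀ u ≤ rho + hStar z₀ := fun u => by
  rw [bellmanObj_eq _ hz, bellman_hStar hz]
  exact le_T (coord_mem hz u) hz ⟨1, fun _ hw => hStar_le_one hw⟩

lemma sum_expReward_le_rho (N : ℕ) :
    ∑ t ∈ Finset.range N, expReward z₀ π t ≤ N * rho + 5 := by
  have h := sum_expReward_le hz π (fun z hz => bellmanObj_hStar_le hz) N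
  have h2 := expPotential_mono hz π (f := fun _ => -4) (g := hStar) (fun z hz => hStar_ge hz) N
  rw [expPotential_const] at h2
  linarith [hStar_le_one hz]

lemma expReward_ge (t : ℕ) : -1 ≤ expReward z₀ π t := by
  rw [← expPotential_const (z₀ := z₀) π (-1) t]
  exact Finset.sum_le_sum fun _ _ => mul_le_mul_of_nonneg_left (reward_ge (beliefAt_mem hz π _) _)
    (histProb_nonneg hz π _)

omit hz in
lemma tendsto_rho_add_div (c : ℝ) :
    Tendsto (fun N : ℕ => rho + c / (N : ℝ)) atTop (nhds rho) := by
  simpa using (tendsto_const_div_atTop_nhds_zero_nat c).const_add rho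

omit hz in
lemma le_rho_add_div {N : ℕ} (hN : 0 < N) {x c : ℝ} : x / N ≤ rho + c / N ↔ x ≤ N * rho + c := by
  have : (0 : ℝ) < N := Nat.cast_pos.2 hN
  rw [div_le_iff₀ this, add_mul, div_mul_cancel₀ _ this.ne', mul_comm rho]

omit hz in
lemma rho_add_div_le {N : ℕ} (hN : 0 < N) {x c : ℝ} : rho + c / N ≤ x / N ↔ N * rho + c ≤ x := by
  have : (0 : ℝ) < N := Nat.cast_pos.2 hN
  rw [le_div_iff₀ this, add_mul, div_mul_cancel₀ _ this.ne', mul_comm rho]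

lemma avgReward_le : avgReward z₀ π ≤ rho := by
  rw [avgReward, ← (tendsto_rho_add_div 5).liminf_eq]
  refine liminf_le_liminf ?_ ?_ ?_
  · filter_upwards [eventually_gt_atTop 0] with N hN
    exact (le_rho_add_div hN).2 (sum_expReward_le_rho hz π N)
  · refine isBoundedUnder_of_eventually_ge (a := -1) ?_
    filter_upwards [eventually_gt_atTop 0] with N hN
    rw [le_div_iff₀ (Nat.cast_pos.2 hN)]
    have := Finset.card_nsmul_le_sum (Finset.range N) (expReward z₀ π) (-1)
      fun t _ => expReward_ge hz π t
    simpa [mul_comm] using this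
  · exact (tendsto_rho_add_div 5).isCoboundedUnder_ge

lemma avgReward_eq_of_le {c : ℝ}
    (h : ∀ N : ℕ, N * rho + c ≤ ∑ t ∈ Finset.range N, expReward z₀ π t) :
    avgReward z₀ π = rho := by
  refine Tendsto.liminf_eq (tendsto_of_tendsto_of_tendsto_of_le_of_le'
    (tendsto_rho_add_div c) (tendsto_rho_add_div 5) ?_ ?_)
  · filter_upwards [eventually_gt_atTop 0] with N hN
    exact (rho_add_div_le hN).2 (h N)
  · filter_upwards [eventually_gt_atTop 0] with N hN
    exact (le_rho_add_div hN).2 (sum_expReward_le_rho hz π N)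

lemma optReward_eq {π : Policy} (h : avgReward z₀ π = rho) : optReward z₀ = rho :=
  have : Nonempty Policy := ⟨π⟩
  le_antisymm (ciSup_le fun π => avgReward_le hz π)
    (h.symm.trans_le (le_ciSup ⟨rho, by rintro _ ⟨π, rfl⟩; exact avgReward_le hz π⟩ π))

end

/-! ### An optimal stationary policy -/

lemma clamp01_mem (x : ℝ) : max 0 (min x 1) ∈ Icc (0 : ℝ) 1 :=
  ⟨le_max_left _ _, max_le zero_le_one (min_le_right _ _)⟩

/-- `p(0|0)` for the optimal stationary policy. -/
def optZero (z : ℝ) : ℝ := if z ≤ b₂ then 1 else if z ≤ b₃ then b₂ / z else b₃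

/-- The optimal stationary policy. -/
def optAction (z : ℝ) : Action :=
  mkAction _ _ (clamp01_mem (optZero z)) (clamp01_mem (optZero (1 - z)))

lemma measurable_optZero : Measurable optZero := by
  unfold optZero
  refine Measurable.ite measurableSet_Iic measurable_const
    (Measurable.ite measurableSet_Iic ?_ measurable_const)
  fun_prop

lemma measurable_optAction : Measurable optAction := by
  have h1 := measurable_optZero
  refine Measurable.subtype_mk (measurable_pi_lambda _ fun s => measurable_pi_lambda _ fun x => ?_)
  cases s <;> cases x <;> simp only [Bool.false_eq_true, if_true, if_false] <;> fun_prop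

lemma optZero_mem {z : ℝ} : optZero z ∈ Icc (0 : ℝ) 1 := by
  unfold optZero
  split_ifs with h1 h2
  · exact ⟨zero_le_one, le_rfl⟩
  · have := b₂_pos.trans (not_le.1 h1)
    exact ⟨(div_pos b₂_pos this).le, (div_le_one this).2 (not_le.1 h1).le⟩
  · exact ⟨b₃_pos.le, (b₃_lt_b₄.trans b₄_lt_one).le⟩

lemma optAction_coord (z : ℝ) :
    z * (optAction z).1 false false = z * optZero z ∧
      (1 - z) * (optAction z).1 true true = (1 - z) * optZero (1 - z) := by
  have h : ∀ z, max 0 (min (optZero z) 1) = optZero z := fun z => by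
    rw [min_eq_left optZero_mem.2, max_eq_right optZero_mem.1]
  simp [optAction, mkAction, h]

lemma mul_optZero (z : ℝ) : z * optZero z = deltaT z := by
  have e3 : (√5 - 1) / 2 = b₃ := rfl
  have e2 : (3 - √5) / 2 = b₂ := rfl
  unfold optZero deltaT
  rw [e2, e3]
  split_ifs with h1 h2
  · ring
  · have := b₂_pos.trans (not_le.1 h1)
    field_simp
  · ring

lemma deltaT_one_sub (z : ℝ) : deltaT (1 - z) = gammaT z := by
  have e3 : (√5 - 1) / 2 = b₃ := rfl
  have e2 : (3 - √5) / 2 = b₂ := rfl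
  unfold deltaT gammaT
  rw [e2, e3]
  rcases lt_trichotomy z b₂ with h | rfl | h
  · rw [if_pos h.le, if_neg (by linarith [one_sub_b₃, b₂_lt_b₃]),
      if_neg (by linarith [one_sub_b₂])]
  · rw [one_sub_b₂, if_neg b₂_lt_b₃.not_ge, if_pos le_rfl, if_pos le_rfl, b₃_mul_b₃, b₂_eq]
  · rcases lt_trichotomy z b₃ with h' | rfl | h'
    · rw [if_neg (by linarith [one_sub_b₃]), if_pos (by linarith [one_sub_b₂]), if_neg h.not_ge,
        if_pos h'.le]
    · rw [one_sub_b₃, if_pos le_rfl, if_neg h.not_ge, if_pos le_rfl]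
    · rw [if_pos (by linarith [one_sub_b₃]), if_neg h.not_ge, if_neg h'.not_ge]

lemma bellmanObj_optAction (h : ℝ → ℝ) {z : ℝ} (hz : z ∈ Icc (0 : ℝ) 1) :
    bellmanObj h z (optAction z) = bracket h (deltaT z) (gammaT z) := by
  rw [bellmanObj_eq h hz, (optAction_coord z).1, (optAction_coord z).2, mul_optZero, mul_optZero,
    deltaT_one_sub]

lemma hTilde_ge {z : ℝ} (hz : z ∈ Icc b₁ b₄) : -1 ≤ hTilde z := by
  have key : ∀ z ∈ Icc b₁ b₃, -1 ≤ hTilde z := by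
    intro z hz
    rcases le_total z b₂ with h | h
    · have hz1 : z ≤ 1 := by linarith [b₂_lt_b₃, b₃_lt_b₄, b₄_lt_one]
      have hz0 : 0 ≤ z := b₁_pos.le.trans hz.1
      rw [hTilde_left h]
      have := mul_le_of_le_one_right rho_pos.le hz1
      linarith [H_nonneg hz0 hz1, rho_lt_one]
    · rw [hTilde_mid ⟨h, hz.2⟩]; norm_num
  rcases le_total z b₃ with h | h
  · exact key z ⟨hz.1, h⟩
  · rw [← hTilde_one_sub]
    exact key _ ⟨by linarith [hz.2, one_sub_b₄], by linarith [one_sub_b₃, b₂_lt_b₃]⟩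

open Classical in
/-- A potential that certifies that the stationary policy attains average reward `ρ`. -/
def potential (z : ℝ) : ℝ := if z ∈ Icc b₁ b₄ then hTilde z else -5

lemma potential_ge (z : ℝ) : -5 ≤ potential z := by
  unfold potential
  split_ifs with h
  · linarith [hTilde_ge h]
  · exact le_rfl

lemma potential_eqOn : EqOn potential hTilde (Icc b₁ b₄) := fun _ hz => if_pos hz

lemma potential_one_sub (z : ℝ) : potential (1 - z) = potential z := by
  unfold potential
  by_cases h : z ∈ Icc b₁ b₄
  · rw [if_pos h, if_pos (one_sub_mem_Icc h), hTilde_one_sub]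
  · rw [if_neg h, if_neg fun h' => h (by simpa using one_sub_mem_Icc h')]

/-- Below `b₁` the next belief is `b₁` with probability at least `1/2`. The reward is at least `-1`
and the other branch costs at most `5/2`, which leaves more than `rho - 5`. -/
lemma potential_le_bracket_of_lt {z : ℝ} (h0 : 0 ≤ z) (hz : z < b₁) :
    rho - 5 ≤ bracket potential z (b₃ * (1 - z)) := by
  have h1 : z < 1 := by linarith [b₁_lt_b₂, b₂_lt_b₃, b₃_lt_b₄, b₄_lt_one]
  have hbox := box_left ⟨h0, h1.le⟩
  obtain ⟨n1, n2, n3⟩ := box_nonneg hbox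
  rw [bracket]
  have hb : b₁ ≤ b₄ := (b₁_lt_b₂.trans (b₂_lt_b₃.trans b₃_lt_b₄)).le
  rw [left_next_true h1, potential_eqOn ⟨le_rfl, hb⟩, hTilde_b₁]
  have k1 := H_nonneg (q := 1 / 2 + (z - b₃ * (1 - z)) / 2) (by linarith) (by linarith)
  have hp : z ≤ b₃ * (1 - z) := by
    have e1 := b₁_eq
    nlinarith [b₃_lt, b₃_gt]
  have k2 := mul_le_mul_of_nonneg_left (potential_ge (2 * z / (1 + z - b₃ * (1 - z))))
    (show 0 ≤ (1 + z - b₃ * (1 - z)) / 2 by linarith)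
  have k3 : 0 ≤ (1 - z + b₃ * (1 - z)) / 2 * (rho + b₁) :=
    mul_nonneg (by linarith) (by linarith [rho_pos, b₁_pos])
  linarith [rho_lt_one]

lemma potential_le_bellmanObj {z : ℝ} (hz : z ∈ Icc (0 : ℝ) 1) :
    rho + potential z ≤ bellmanObj potential z (optAction z) := by
  rw [bellmanObj_optAction _ hz]
  by_cases h : z ∈ Icc b₁ b₄
  · rw [bracket_hTilde potential_eqOn h, potential_eqOn h]
  have e3 : (√5 - 1) / 2 = b₃ := rfl
  have e2 : (3 - √5) / 2 = b₂ := rfl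
  have hv : potential z = -5 := if_neg h
  rw [hv]
  rcases lt_or_ge z b₁ with h1 | h1
  · have h2 := h1.le.trans b₁_lt_b₂.le
    rw [deltaT, gammaT, e2, e3, if_pos h2, if_pos h2]
    exact potential_le_bracket_of_lt hz.1 h1
  · have h2 : b₄ < z := not_le.1 fun h' => h ⟨h1, h'⟩
    rw [← bracket_swap, funext potential_one_sub, ← deltaT_one_sub]
    have h3 : 1 - z < b₁ := by linarith [one_sub_b₄]
    have e4 : deltaT z = gammaT (1 - z) := by rw [← deltaT_one_sub, sub_sub_cancel]
    have h4 := h3.le.trans b₁_lt_b₂.le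
    rw [e4, deltaT, gammaT, e2, e3, if_pos h4, if_pos h4]
    exact potential_le_bracket_of_lt (sub_nonneg.2 hz.2) h3

lemma beliefAt_stationary (z₀ : ℝ) (μ : ℝ → Action) (w : List Bool) :
    beliefAt z₀ (stationary z₀ μ) w = stationaryBelief z₀ μ w := by
  induction w with
  | nil => rfl
  | cons y w ih => rw [beliefAt, stationaryBelief, ih, stationary]

lemma potential_le (z : ℝ) : potential z ≤ 1 := by
  unfold potential
  split_ifs with h
  · rw [← hZero_eqOn h]
    exact hZero_le_one z
  · norm_num

lemma avgReward_optAction {z₀ : ℝ} (hz : z₀ ∈ Icc (0 : ℝ) 1) :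
    avgReward z₀ (stationary z₀ optAction) = rho := by
  refine avgReward_eq_of_le hz _ (c := -6) fun N => ?_
  have h := le_sum_expReward hz (stationary z₀ optAction) (f := potential) (c := rho) (fun w => by
    have := potential_le_bellmanObj (beliefAt_mem hz (stationary z₀ optAction) w)
    rwa [stationary, ← beliefAt_stationary]) N
  have h2 := expPotential_mono hz (stationary z₀ optAction) (f := potential) (g := fun _ => 1)
    (fun z _ => potential_le z) N
  rw [expPotential_const] at h2
  linarith [potential_ge z₀]

/-! ### The converse: a test distribution on output sequences -/

/-- The next node of the test distribution after an output. -/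
def testNext : Option Bool → Bool → Option Bool
  | none, y => some (!y)
  | some b, y => if y = b then none else some b

/-- The output distribution at a node. -/
def testKernel : Option Bool → Bool → ℝ
  | none, _ => 1 / 2
  | some b, y => if y = b then b₂ else b₃

/-- The relative value of channel state `s` at a node. -/
def testValue : Option Bool → Bool → ℝ
  | none, _ => 1
  | some b, s => if s = b then rho + 1 else rho

/-- The node reached after the given outputs (most recent first). -/
def testState : List Bool → Option Bool
  | [] => none
  | y :: w => testNext (testState w) y

/-- The test probability of the given outputs (most recent first). -/
def testProb : List Bool → ℝ
  | [] => 1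
  | y :: w => testProb w * testKernel (testState w) y

lemma testKernel_pos (c : Option Bool) (y : Bool) : 0 < testKernel c y := by
  rcases c with _ | b
  · norm_num [testKernel]
  · cases b <;> cases y <;> simp [testKernel, b₂_pos, b₃_pos]

lemma sum_testKernel (c : Option Bool) : ∑ y, testKernel c y = 1 := by
  rcases c with _ | b
  · norm_num [testKernel]
  · cases b <;> simp [testKernel, b₂_eq]

lemma testProb_pos (w : List Bool) : 0 < testProb w := by
  induction w with
  | nil => exact zero_lt_one
  | cons y w ih => exact mul_pos ih (testKernel_pos _ _)

lemma sum_testProb (t : ℕ) : ∑ w : Fin t → Bool, testProb (List.ofFn w) = 1 := by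
  induction t with
  | zero => simp [testProb]
  | succ t ih =>
    rw [sum_ofFn_succ, ← ih]
    refine Finset.sum_congr rfl fun w _ => ?_
    simp only [testProb]
    rw [← Finset.mul_sum, sum_testKernel, mul_one]

lemma testValue_nonneg (c : Option Bool) (s : Bool) : 0 ≤ testValue c s := by
  have := rho_pos
  rcases c with _ | b
  · exact zero_le_one
  · cases b <;> cases s <;> simp [testValue] <;> linarith

lemma channelProb_nonneg (x s y : Bool) : 0 ≤ channelProb x s y := by
  unfold channelProb
  split_ifs <;> norm_num

lemma sum_channelProb (x s : Bool) : ∑ y, channelProb x s y = 1 := by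
  cases x <;> cases s <;> norm_num [channelProb]

/-- The test law is the output law of the optimal policy: `none` stands for the beliefs `b₂`, `b₃`,
`some false` for `b₁`, `some true` for `b₄`. `testValue` records the supporting lines of `hTilde`
there, evaluated at the two pure states. Equality holds except when the state is `b` at node `some
b` and the input differs from it. -/
lemma one_step_divergence (c : Option Bool) (s x : Bool) :
    ∑ y, channelProb x s y * (Real.logb 2 (channelProb x s y / testKernel c y) +
      testValue (testNext c y) (nextState s x y)) ≤ rho + testValue c s := by
  have h2 : Real.logb 2 2 = 1 := Real.logb_self_eq_one one_lt_two
  have hb2 : Real.logb 2 (2⁻¹ / b₂) = 2 * rho - 1 := by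
    rw [Real.logb_div (by norm_num) b₂_pos.ne', Real.logb_inv, h2, logb_b₂]; ring
  have hb3 : Real.logb 2 (2⁻¹ / b₃) = rho - 1 := by
    rw [Real.logb_div (by norm_num) b₃_pos.ne', Real.logb_inv, h2, logb_b₃]; ring
  have h1 : (2 : ℝ)⁻¹ + 2⁻¹ = 1 := by norm_num
  rcases c with _ | b
  · cases s <;> cases x <;>
      simp [channelProb, testKernel, testValue, testNext, nextState, h1] <;> linarith [rho_pos]
  · cases b <;> cases s <;> cases x <;>
      simp [channelProb, testKernel, testValue, testNext, nextState, h1, hb2, hb3, logb_b₂,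
        logb_b₃] <;> linarith [rho_pos]

lemma chanOutProb_nonneg (s₀ : Bool) (e : List Bool → Bool) (w : List Bool) :
    0 ≤ chanOutProb s₀ e w := by
  induction w with
  | nil => exact zero_le_one
  | cons y w ih => exact mul_nonneg ih (channelProb_nonneg _ _ _)

lemma sum_chanOutProb (s₀ : Bool) (e : List Bool → Bool) (t : ℕ) :
    ∑ w : Fin t → Bool, chanOutProb s₀ e (List.ofFn w) = 1 := by
  induction t with
  | zero => simp [chanOutProb]
  | succ t ih =>
    rw [sum_ofFn_succ, ← ih]
    refine Finset.sum_congr rfl fun w _ => ?_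
    simp only [chanOutProb]
    rw [← Finset.mul_sum, sum_channelProb, mul_one]

lemma divergence_add_value_le (s₀ : Bool) (e : List Bool → Bool) (N : ℕ) :
    ∑ w : Fin N → Bool, chanOutProb s₀ e (List.ofFn w) *
      (Real.logb 2 (chanOutProb s₀ e (List.ofFn w) / testProb (List.ofFn w)) +
        testValue (testState (List.ofFn w)) (chanState s₀ e (List.ofFn w))) ≤ N * rho + 1 := by
  induction N with
  | zero => simp [chanOutProb, testProb, testState, testValue]
  | succ N ih =>
    rw [sum_ofFn_succ N fun w => chanOutProb s₀ e w * (Real.logb 2 (chanOutProb s₀ e w / testProb w)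
      + testValue (testState w) (chanState s₀ e w))]
    have step : ∀ w : List Bool, ∑ y, chanOutProb s₀ e (y :: w) *
        (Real.logb 2 (chanOutProb s₀ e (y :: w) / testProb (y :: w)) +
          testValue (testState (y :: w)) (chanState s₀ e (y :: w))) ≤
        chanOutProb s₀ e w * (Real.logb 2 (chanOutProb s₀ e w / testProb w) +
          testValue (testState w) (chanState s₀ e w)) + chanOutProb s₀ e w * rho := by
      intro w
      have hP := chanOutProb_nonneg s₀ e w
      have hterm : ∀ y, chanOutProb s₀ e (y :: w) *
          (Real.logb 2 (chanOutProb s₀ e (y :: w) / testProb (y :: w)) +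
            testValue (testState (y :: w)) (chanState s₀ e (y :: w))) =
          channelProb (e w) (chanState s₀ e w) y *
            (chanOutProb s₀ e w * Real.logb 2 (chanOutProb s₀ e w / testProb w)) +
          chanOutProb s₀ e w * (channelProb (e w) (chanState s₀ e w) y *
            (Real.logb 2 (channelProb (e w) (chanState s₀ e w) y / testKernel (testState w) y) +
              testValue (testNext (testState w) y) (nextState (chanState s₀ e w) (e w) y))) := by
        intro y
        simp only [chanOutProb, testProb, testState, chanState]
        -- The logarithm splits only for positive factors; otherwise both sides carry a zero weight.
        rcases hP.eq_or_lt with h0 | h0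
        · simp [← h0]
        rcases (channelProb_nonneg (e w) (chanState s₀ e w) y).eq_or_lt with h1 | h1
        · simp [← h1]
        rw [mul_div_mul_comm, Real.logb_mul (div_pos h0 (testProb_pos w)).ne'
          (div_pos h1 (testKernel_pos _ _)).ne']
        ring
      rw [Finset.sum_congr rfl fun y _ => hterm y, Finset.sum_add_distrib, ← Finset.sum_mul,
        sum_channelProb, ← Finset.mul_sum]
      have := mul_le_mul_of_nonneg_left
        (one_step_divergence (testState w) (chanState s₀ e w) (e w)) hP
      linarith
    refine (Finset.sum_le_sum fun w _ => step (List.ofFn w)).trans ?_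
    rw [Finset.sum_add_distrib, ← Finset.sum_mul, sum_chanOutProb]
    push_cast
    linarith

lemma divergence_le (s₀ : Bool) (e : List Bool → Bool) (N : ℕ) :
    ∑ w : Fin N → Bool, chanOutProb s₀ e (List.ofFn w) *
      Real.logb 2 (chanOutProb s₀ e (List.ofFn w) / testProb (List.ofFn w)) ≤ N * rho + 1 := by
  refine (Finset.sum_le_sum fun w _ => ?_).trans (divergence_add_value_le s₀ e N)
  exact mul_le_mul_of_nonneg_left (le_add_of_nonneg_right (testValue_nonneg _ _))
    (chanOutProb_nonneg _ _ _)

/-- If `Q` gives the event `A` mass at most `1 / M`, then the divergence `D(P ‖ Q)` is at least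
`P(A) log M - 1`. -/
lemma le_divergence {Ω : Type*} [Fintype Ω] (P Q : Ω → ℝ) (hP : ∀ w, 0 ≤ P w)
    (hP1 : ∑ w, P w = 1) (hQ : ∀ w, 0 < Q w) (hQ1 : ∑ w, Q w = 1) (A : Ω → Prop)
    [DecidablePred A] {M : ℝ} (hM : 1 ≤ M) (hA : M * ∑ w, (if A w then Q w else 0) ≤ 1) :
    (∑ w, if A w then P w else 0) * Real.logb 2 M - 1 ≤ ∑ w, P w * Real.logb 2 (P w / Q w) := by
  have hM0 : 0 < M := zero_lt_one.trans_le hM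
  -- `R` mixes `Q` evenly with `M Q` restricted to `A`, so its mass is at most `1`. Gibbs'
  -- inequality for `P` against `R` gives `log M - 1` on `A` and `-1` elsewhere.
  set R : Ω → ℝ := fun w => Q w * (((if A w then M else 0) + 1) / 2) with hR
  have hRpos : ∀ w, 0 < R w := fun w => by
    refine mul_pos (hQ w) ?_
    split_ifs <;> linarith
  have hR1 : ∑ w, R w ≤ 1 := by
    have : ∀ w, R w = M / 2 * (if A w then Q w else 0) + Q w / 2 := fun w => by
      simp only [hR]; split_ifs <;> ring
    rw [Finset.sum_congr rfl fun w _ => this w, Finset.sum_add_distrib, ← Finset.mul_sum,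
      ← Finset.sum_div, hQ1]
    linarith
  have hgibbs : ∑ w, P w * (Real.logb 2 (R w) - Real.logb 2 (P w)) ≤ 0 := by
    refine (Finset.sum_le_sum fun w _ => mul_logb_sub_le (hP w) (hRpos w)).trans ?_
    rw [← Finset.sum_div, Finset.sum_sub_distrib, hP1]
    exact div_nonpos_of_nonpos_of_nonneg (by linarith) (Real.log_pos one_lt_two).le
  have hterm : ∀ w, (if A w then P w else 0) * Real.logb 2 M - P w ≤
      P w * Real.logb 2 (P w / Q w) + P w * (Real.logb 2 (R w) - Real.logb 2 (P w)) := by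
    intro w
    rcases (hP w).eq_or_lt with h0 | h0
    · simp [← h0]
    have hc : 0 < ((if A w then M else 0) + 1) / 2 := by split_ifs <;> linarith
    have e1 : Real.logb 2 (R w) = Real.logb 2 (Q w) +
      (Real.logb 2 ((if A w then M else 0) + 1) - 1) := by
      simp only [hR]
      rw [Real.logb_mul (hQ w).ne' hc.ne', logb_half_mul (by linarith)]
    rw [e1, Real.logb_div h0.ne' (hQ w).ne']
    have e2 : (if A w then P w else 0) * Real.logb 2 M ≤
        P w * Real.logb 2 ((if A w then M else 0) + 1) := by
      split_ifs
      · exact mul_le_mul_of_nonneg_left (Real.logb_le_logb_of_le one_lt_two hM0 (by linarith)) h0.le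
      · simp
    linarith
  have := Finset.sum_le_sum fun w (_ : w ∈ Finset.univ) => hterm w
  rw [Finset.sum_sub_distrib, ← Finset.sum_mul, hP1, Finset.sum_add_distrib] at this
  linarith

lemma log_card_le {N M : ℕ} (hM : 0 < M) (c : FeedbackCode N M) (s₀ : Bool) {ε : ℝ}
    (hc : ∀ m, c.errorProb s₀ m ≤ ε) : (1 - ε) * Real.logb 2 M ≤ N * rho + 2 := by
  have hM1 : (1 : ℝ) ≤ M := Nat.one_le_cast.2 hM
  have hsum : ∑ m : Fin M, ∑ y : Fin N → Bool,
      (if c.dec s₀ y = m then testProb (List.ofFn y) else 0) = 1 := by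
    rw [Finset.sum_comm]
    simp [sum_testProb]
  have : Nonempty (Fin M) := ⟨⟨0, hM⟩⟩
  -- The decoding regions partition the outputs, so some message has a region of test mass at most
  -- `1 / M`.
  obtain ⟨m, -, hm⟩ := Finset.exists_le_of_sum_le (s := (Finset.univ : Finset (Fin M)))
    (f := fun m => ∑ y : Fin N → Bool, (if c.dec s₀ y = m then testProb (List.ofFn y) else 0))
    (g := fun _ => 1 / (M : ℝ)) Finset.univ_nonempty (by
      rw [hsum]
      have : (M : ℝ) ≠ 0 := by positivity
      simp [this])
  have hm' : (M : ℝ) * ∑ y : Fin N → Bool,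
      (if c.dec s₀ y = m then testProb (List.ofFn y) else 0) ≤ 1 := by
    rwa [le_div_iff₀ (by linarith), mul_comm] at hm
  have h1 := le_divergence (fun y : Fin N → Bool => chanOutProb s₀ (c.enc s₀ m) (List.ofFn y))
    (fun y => testProb (List.ofFn y)) (fun _ => chanOutProb_nonneg _ _ _) (sum_chanOutProb _ _ _)
    (fun _ => testProb_pos _) (sum_testProb N) (fun y => c.dec s₀ y = m) hM1 hm'
  have h2 := divergence_le s₀ (c.enc s₀ m) N
  have h3 : 1 - ε ≤ ∑ y : Fin N → Bool,
      if c.dec s₀ y = m then chanOutProb s₀ (c.enc s₀ m) (List.ofFn y) else 0 := by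
    have he := hc m
    have : (∑ y : Fin N → Bool,
      if c.dec s₀ y = m then chanOutProb s₀ (c.enc s₀ m) (List.ofFn y) else 0) +
        c.errorProb s₀ m = 1 := by
      rw [FeedbackCode.errorProb, ← Finset.sum_add_distrib, ← sum_chanOutProb s₀ (c.enc s₀ m) N]
      refine Finset.sum_congr rfl fun y _ => ?_
      split_ifs <;> simp
    linarith
  have h4 := mul_le_mul_of_nonneg_right h3 (Real.logb_nonneg one_lt_two hM1)
  linarith

lemma IsAchievable.le_rho {s₀ : Bool} {R : ℝ} (h : IsAchievable s₀ R) : R ≤ rho := by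
  by_contra! hR
  have hR0 := rho_pos.trans hR
  -- This error level makes `(1 - ε) R = (R + rho) / 2`, still above `rho`; the additive constant
  -- `2` is beaten once `N (R - rho) > 4`.
  obtain ⟨N₀, hN₀⟩ := h ((R - rho) / (2 * R)) (div_pos (by linarith) (by linarith))
  obtain ⟨N₁, hN₁⟩ := exists_nat_gt (4 / (R - rho))
  set N := max N₀ N₁
  obtain ⟨c, hc⟩ := hN₀ N (le_max_left _ _)
  have hpos : (0 : ℝ) < 2 ^ ((N : ℝ) * R) := by positivity
  have h1 := log_card_le (Nat.ceil_pos.2 hpos) c s₀ hc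
  have h2 : (N : ℝ) * R ≤ Real.logb 2 (⌈(2 : ℝ) ^ ((N : ℝ) * R)⌉₊ : ℝ) := by
    rw [Real.le_logb_iff_rpow_le one_lt_two (hpos.trans_le (Nat.le_ceil _))]
    exact Nat.le_ceil _
  have e : 1 - (R - rho) / (2 * R) = (R + rho) / (2 * R) := by field_simp; ring
  rw [e] at h1
  have h3 := mul_le_mul_of_nonneg_left h2
    (div_nonneg (by linarith [rho_pos]) (by linarith) : 0 ≤ (R + rho) / (2 * R))
  have e2 : (R + rho) / (2 * R) * (N * R) = N * ((R + rho) / 2) := by field_simp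
  have h4 : (N₁ : ℝ) ≤ N := Nat.cast_le.2 (le_max_right _ _)
  have h5 := hN₁.trans_le h4
  rw [div_lt_iff₀ (by linarith)] at h5
  linarith

/-! ### Achievability: a zero-error scheme -/

/-- The channel state when the encoder repeats (`a t = false`) or flips (`a t = true`) it. -/
def flipState (s₀ : Bool) (a : ℕ → Bool) : List Bool → Bool
  | [] => s₀
  | y :: w => nextState (flipState s₀ a w) (Bool.xor (flipState s₀ a w) (a w.length)) y

/-- The encoder that sends a ball equal to the channel state unless `a t` holds. -/
def flipEnc (s₀ : Bool) (a : ℕ → Bool) (w : List Bool) : Bool :=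
  Bool.xor (flipState s₀ a w) (a w.length)

lemma chanState_flipEnc (s₀ : Bool) (a : ℕ → Bool) (w : List Bool) :
    chanState s₀ (flipEnc s₀ a) w = flipState s₀ a w := by
  induction w with
  | nil => rfl
  | cons y w ih => rw [chanState, flipState, ih, flipEnc]

/-- Without a flip the output reveals the current state and leaves it unchanged; with a flip the
output is a fair bit and the complementary ball stays. -/
lemma flipEnc_step {s₀ : Bool} {a : ℕ → Bool} {y : Bool} {w : List Bool}
    (h : 0 < chanOutProb s₀ (flipEnc s₀ a) (y :: w)) :
    0 < chanOutProb s₀ (flipEnc s₀ a) w ∧ flipState s₀ a (y :: w) = Bool.xor y (a w.length) ∧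
      (a w.length = false → flipState s₀ a w = y) := by
  rw [chanOutProb, chanState_flipEnc, flipEnc] at h
  have hw := (chanOutProb_nonneg s₀ (flipEnc s₀ a) w).lt_of_ne (left_ne_zero_of_mul h.ne').symm
  have hc := right_ne_zero_of_mul h.ne'
  refine ⟨hw, ?_⟩
  rw [flipState]
  generalize flipState s₀ a w = s at hc ⊢
  generalize a w.length = b at hc ⊢
  revert hc
  cases s <;> cases b <;> cases y <;> simp [channelProb, nextState]

/-- Two flip sequences without consecutive flips that can lead to the same outputs and the same
final state are equal. -/
lemma flips_unique {s₀ : Bool} {a a' : ℕ → Bool} (ha : ∀ t, ¬(a t = true ∧ a (t + 1) = true))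
    (ha' : ∀ t, ¬(a' t = true ∧ a' (t + 1) = true)) (w : List Bool)
    (h : 0 < chanOutProb s₀ (flipEnc s₀ a) w) (h' : 0 < chanOutProb s₀ (flipEnc s₀ a') w)
    (hs : flipState s₀ a w = flipState s₀ a' w) : ∀ t < w.length, a t = a' t := by
  induction w with
  | nil => simp
  | cons y w ih =>
    obtain ⟨h1, h2, h3⟩ := flipEnc_step h
    obtain ⟨h1', h2', h3'⟩ := flipEnc_step h'
    rw [h2, h2'] at hs
    have hn : a w.length = a' w.length := by simpa using hs
    -- Decoding runs backwards. Without a flip the earlier state is the output `y`; after a flip the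
    -- preceding step was no flip, so the earlier state is the preceding output, or `s₀` at the
    -- start.
    have hst : flipState s₀ a w = flipState s₀ a' w := by
      rcases hb : a w.length with _ | _
      · rw [h3 hb, h3' (hn ▸ hb)]
      · rcases w with _ | ⟨y', w'⟩
        · rfl
        · rw [(flipEnc_step h1).2.1, (flipEnc_step h1').2.1]
          have e : a w'.length = false := Bool.eq_false_iff.2 fun hc => ha w'.length ⟨hc, hb⟩
          have e' : a' w'.length = false :=
            Bool.eq_false_iff.2 fun hc => ha' w'.length ⟨hc, hn ▸ hb⟩
          rw [e, e']
    intro t ht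
    rcases (Nat.lt_succ_iff_lt_or_eq.1 ht) with h | rfl
    · exact ih h1 h1' hst t h
    · exact hn

lemma exists_flip_sequences (n : ℕ) : ∃ F : Finset (ℕ → Bool), F.card = Nat.fib (n + 2) ∧
    ∀ a ∈ F, (∀ t, ¬(a t = true ∧ a (t + 1) = true)) ∧ ∀ t, n ≤ t → a t = false := by
  classical
  induction n using Nat.twoStepInduction with
  | zero => exact ⟨{fun _ => false}, by simp⟩
  | one =>
    refine ⟨{fun _ => false, fun t => decide (t = 0)}, ?_, ?_⟩
    · rw [Finset.card_pair]
      · rfl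
      · intro h
        simpa using congrFun h 0
    · simp only [Finset.mem_insert, Finset.mem_singleton]
      rintro a (rfl | rfl)
      · simp
      · refine ⟨by simp, fun t ht => ?_⟩
        simp only [decide_eq_false_iff_not]
        omega
  | more n ih1 ih2 =>
    obtain ⟨F, hF, hF'⟩ := ih1
    obtain ⟨G, hG, hG'⟩ := ih2
    -- The Fibonacci recursion: a flip at time `n + 1` forces none at time `n`, leaving a sequence
    -- from `F`; without one the sequence is in `G`.
    let up : (ℕ → Bool) → ℕ → Bool := fun a => Function.update a (n + 1) true
    refine ⟨F.image up ∪ G, ?_, ?_⟩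
    · rw [Finset.card_union_of_disjoint, Finset.card_image_of_injOn, hF, hG,
        Nat.fib_add_two (n := n + 2)]
      · intro a ha b hb hab
        funext t
        rcases eq_or_ne t (n + 1) with rfl | ht
        · rw [(hF' a ha).2 _ (by omega), (hF' b hb).2 _ (by omega)]
        · simpa [up, ht] using congrFun hab t
      · rw [Finset.disjoint_left]
        intro a ha hb
        obtain ⟨a', -, rfl⟩ := Finset.mem_image.1 ha
        have := (hG' _ hb).2 (n + 1) le_rfl
        simp [up] at this
    · intro a ha
      rcases Finset.mem_union.1 ha with ha | ha
      · obtain ⟨b, hb, rfl⟩ := Finset.mem_image.1 ha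
        obtain ⟨hb1, hb2⟩ := hF' b hb
        refine ⟨fun t => ?_, fun t ht => ?_⟩
        · simp only [up, Function.update_apply]
          rcases eq_or_ne t (n + 1) with rfl | h1
          · simp [hb2 (n + 2) (by omega)]
          rcases eq_or_ne t n with rfl | h2
          · simp [hb2 t le_rfl]
          · rw [if_neg h1, if_neg (by omega)]
            exact hb1 t
        · simp only [up, Function.update_apply]
          rw [if_neg (by omega)]
          exact hb2 t (by omega)
      · exact ⟨(hG' a ha).1, fun t ht => (hG' a ha).2 t (by omega)⟩

lemma rpow_le_fib (n : ℕ) : (2 : ℝ) ^ (rho * n) ≤ Nat.fib (n + 2) := by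
  have hpos : (0 : ℝ) < (1 + √5) / 2 := by positivity
  rw [Real.rpow_mul (by norm_num), rho, Real.rpow_logb (by norm_num) (by norm_num) hpos,
    Real.rpow_natCast]
  induction n using Nat.twoStepInduction with
  | zero => simp
  | one =>
    norm_num [Nat.fib_add_two]
    linarith [sqrt_five_lt]
  | more n ih1 ih2 =>
    rw [Nat.fib_add_two (n := n + 2)]
    push_cast
    refine le_trans (le_of_eq ?_) (add_le_add ih1 ih2)
    rw [pow_add, pow_add]
    linear_combination ((1 + √5) / 2) ^ n / 4 * sqrt_five_sq

/-- The extra channel use at time `n` never flips, so the last output reveals the final state needed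
to start the backward decoding. -/
lemma exists_zeroError_code {n M : ℕ} (hM0 : 0 < M) (hM : M ≤ Nat.fib (n + 2)) (s₀ : Bool) :
    ∃ c : FeedbackCode (n + 1) M, ∀ m, c.errorProb s₀ m = 0 := by
  classical
  obtain ⟨F, hF, hF'⟩ := exists_flip_sequences n
  let word : Fin M → ℕ → Bool := fun m => F.equivFin.symm (Fin.castLE (hF ▸ hM) m)
  have hword : ∀ m, word m ∈ F := fun m => (F.equivFin.symm (Fin.castLE (hF ▸ hM) m)).2
  have hinj : Function.Injective word := fun m m' h => by
    have := F.equivFin.symm.injective (Subtype.ext h)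
    exact Fin.castLE_injective _ this
  let enc : Fin M → List Bool → Bool := fun m => flipEnc s₀ (word m)
  have hunique : ∀ (y : Fin (n + 1) → Bool) m m', 0 < chanOutProb s₀ (enc m) (List.ofFn y) →
      0 < chanOutProb s₀ (enc m') (List.ofFn y) → m = m' := by
    intro y m m' h h'
    obtain ⟨h1, h2⟩ := hF' _ (hword m)
    obtain ⟨h1', h2'⟩ := hF' _ (hword m')
    have hs : flipState s₀ (word m) (List.ofFn y) = flipState s₀ (word m') (List.ofFn y) := by
      rw [List.ofFn_succ] at h h' ⊢
      rw [(flipEnc_step h).2.1, (flipEnc_step h').2.1, h2 _ (by simp), h2' _ (by simp)]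
    refine hinj (funext fun t => ?_)
    rcases lt_or_ge t (n + 1) with ht | ht
    · exact flips_unique h1 h1' _ h h' hs t (by simpa using ht)
    · rw [h2 t (by omega), h2' t (by omega)]
  let dec : (Fin (n + 1) → Bool) → Fin M := fun y =>
    if h : ∃ m, 0 < chanOutProb s₀ (enc m) (List.ofFn y) then h.choose else ⟨0, hM0⟩
  refine ⟨⟨fun _ => enc, fun _ => dec⟩, fun m => Finset.sum_eq_zero fun y _ => ?_⟩
  rw [ite_eq_left_iff]
  intro hne
  by_contra hcon
  have hpos := (chanOutProb_nonneg s₀ (enc m) (List.ofFn y)).lt_of_ne (Ne.symm hcon)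
  have hex : ∃ m, 0 < chanOutProb s₀ (enc m) (List.ofFn y) := ⟨m, hpos⟩
  refine hne ?_
  change dec y = m
  simp only [dec, dif_pos hex]
  exact hunique y _ _ hex.choose_spec hpos

lemma isAchievable_of_lt {s₀ : Bool} {R : ℝ} (hR : R < rho) : IsAchievable s₀ R := by
  intro ε hε
  -- The extra channel use must be paid for: `(n + 1) R ≤ rho n` holds once `n (rho - R) ≥ rho`.
  obtain ⟨N₀, hN₀⟩ := exists_nat_gt (rho / (rho - R))
  refine ⟨N₀ + 1, fun N hN => ?_⟩
  obtain ⟨n, rfl⟩ : ∃ n, N = n + 1 := ⟨N - 1, by omega⟩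
  have hle : ⌈(2 : ℝ) ^ (((n + 1 : ℕ) : ℝ) * R)⌉₊ ≤ Nat.fib (n + 2) := by
    rw [Nat.ceil_le]
    refine le_trans (Real.rpow_le_rpow_of_exponent_le one_le_two ?_) (rpow_le_fib n)
    rw [div_lt_iff₀ (by linarith)] at hN₀
    have h1 : (N₀ : ℝ) ≤ n := Nat.cast_le.2 (by omega)
    have h2 := mul_le_mul_of_nonneg_right h1 (show 0 ≤ rho - R by linarith)
    push_cast
    linarith
  obtain ⟨c, hc⟩ := exists_zeroError_code (Nat.ceil_pos.2 (by positivity)) hle s₀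
  exact ⟨c, fun m => (hc m).trans_le hε.le⟩

lemma feedbackCapacity_eq (s₀ : Bool) : feedbackCapacity s₀ = rho := by
  refine csSup_eq_of_forall_le_of_forall_lt_exists_gt ⟨0, isAchievable_of_lt rho_pos⟩
    (fun R hR => hR.le_rho) fun R hR => ?_
  obtain ⟨R', h1, h2⟩ := exists_between hR
  exact ⟨R', isAchievable_of_lt h2, h1⟩

end

end Trapdoor

theorem theorem9 :
    -- the operator `T` in the coordinates `δ = z p(0|0)`, `γ = (1 - z) p(1|1)`
    (∀ h : ℝ → ℝ, ∀ z ∈ Icc (0 : ℝ) 1, T h z =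
      sSup {r : ℝ | ∃ δ ∈ Icc 0 z, ∃ γ ∈ Icc 0 (1 - z),
        r = H (1 / 2 + (δ - γ) / 2) + δ + γ - 1
          + (1 + δ - γ) / 2 * h (2 * δ / (1 + δ - γ))
          + (1 - δ + γ) / 2 * h (1 - 2 * γ / (1 - δ + γ))}) ∧
    -- the starting function is the greatest concave extension
    hIter 0 ∈ concaveExtensions ∧
    (∀ g ∈ concaveExtensions, ∀ z ∈ Icc (0 : ℝ) 1, g z ≤ hIter 0 z) ∧
    -- `hStar` is the limit of the value iterates, is bounded, and solves Bellman's equation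
    TendstoUniformlyOn hIter hStar atTop (Icc 0 1) ∧
    (∃ B : ℝ, ∀ z ∈ Icc (0 : ℝ) 1, |hStar z| ≤ B) ∧
    (∀ z ∈ Icc (0 : ℝ) 1, rho + hStar z = T hStar z) ∧
    -- `rho` is the optimal average reward
    (∀ z₀ ∈ Icc (0 : ℝ) 1, optReward z₀ = rho) ∧
    -- an optimal stationary policy that takes the actions `(deltaT, gammaT)` on `[b₁, b₄]`,
    -- where these attain the supremum in Bellman's equation
    (∃ μ : ℝ → Action, Measurable μ ∧
      (∀ z ∈ Icc b₁ b₄,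
        z * (μ z).1 false false = deltaT z ∧ (1 - z) * (μ z).1 true true = gammaT z ∧
        bellmanObj hStar z (μ z) = T hStar z) ∧
      ∀ z₀ ∈ Icc (0 : ℝ) 1, avgReward z₀ (stationary z₀ μ) = optReward z₀) ∧
    -- the feedback capacity
    (∀ s₀ : Bool, feedbackCapacity s₀ = rho) := by
  refine ⟨fun h z hz => T_eq_sSup h hz, hIter_zero_mem, fun g hg z hz => le_hIter_zero hg hz,
    tendstoUniformlyOn_hIter, ⟨4, fun z hz => ?_⟩, fun z hz => bellman_hStar hz,
    fun z₀ hz => optReward_eq hz (avgReward_optAction hz),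
    ⟨optAction, measurable_optAction, fun z hz => ⟨?_, ?_, ?_⟩, fun z₀ hz => ?_⟩,
    feedbackCapacity_eq⟩
  · exact abs_le.2 ⟨hStar_ge hz, by linarith [hStar_le_one hz]⟩
  · rw [(optAction_coord z).1, mul_optZero]
  · rw [(optAction_coord z).2, mul_optZero, deltaT_one_sub]
  · rw [bellmanObj_optAction _ (Icc_b_subset hz), bracket_hTilde hStar_eqOn hz,
      ← bellman_hStar (Icc_b_subset hz), hStar_eqOn hz]
  · rw [avgReward_optAction hz, optReward_eq hz (avgReward_optAction hz)]
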